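/- Setting. All indices are modulo $4$. A quad surface with $m\times n$ faces is a map from the vertices of an $(m+1)\times(n+1)$ grid to $\mathbb R^3$. It is a skew-quad (SQ) surface if the four corners of each face are affinely independent, and a V-hedron if at each inner vertex both pairs of opposite face angles are equal. It is continuously flexible if it is the initial member of a continuous one-parameter family of pairwise incongruent quad surfaces such that each face keeps the mutual distances of its four corners. A building block is a quad surface with $3\times 3$ faces. Let $V_0,\dots,V_3$ be a skew quad, i.e. four affinely independent points of $\mathbb R^3$. Put $c_i=V_i-V_{i-1}$, $C_i=c_i/\|c_i\|$, $\lambda_i=\angle(c_i,c_{i+1})$, $n_i=(c_i\times c_{i+1})/\|c_i\times c_{i+1}\|$, $\tau_i=\operatorname{sign}\bigl((c_{i-1}\times c_i)\cdot c_{i+1}\bigr)\,\angle(c_{i-1}\times c_i,\,c_i\times c_{i+1})$. Given $\delta_i\in(0,\pi)$ and $\alpha_i,\beta_i\in\mathbb R$ let $$A_i=\cos\delta_i\,C_i+\sin\delta_i(\cos\alpha_i\; n_i\times C_i+\sin\alpha_i\; n_i),\qquad B_i=\cos\delta_i\,C_{i+1}+\sin\delta_i(\cos\beta_i\; n_i\times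 C_{i+1}+\sin\beta_i\; n_i).$$ For $W_i\in\mathbb R^3$ and real $s_i,t_i$ with $s_it_i<0$ put $P_i=V_i+s_iA_i$, $Q_i=V_i+t_iB_i$; the associated building block $X$ has the central face $V_0V_1V_2V_3$, the side faces $V_iV_{i+1}P_{i+1}Q_i$ and the corner faces $V_iQ_iW_iP_i$. For $e_i,f_i\in\mathbb R$ we say that $X$ is a configuration with parameters $(e,f)$ if $b_i=f_ia_i$, where $a_i=\tan\frac{\alpha_i}2$, $b_i=\tan\frac{\beta_i}2$ (read as $\sin\frac{\beta_i}2\cos\frac{\alpha_i}2=f_i\sin\frac{\alpha_i}2\cos\frac{\beta_i}2$, so that the value $\infty$ is admitted), and $\alpha_{i+1}\equiv\beta_i+\varepsilon_{i+1} \pmod{2\pi}$ with $\varepsilon_{i}=2\arctan e_{i}$. Let $$\begin{aligned} q_2 &= f_0[e_0f_3(e_1e_2f_2 + e_2e_3f_1 + e_1e_3 - f_1f_2) + e_1e_2e_3f_2 - e_3f_1f_2 - e_2f_1 - e_1], \\ q_1 &= e_1e_2f_0f_2f_3 +e_2e_3f_0f_1f_3 + e_1e_3f_0f_3 - e_1e_3f_1f_2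 - f_0f_1f_2f_3 - e_1e_2f_1 - e_2e_3f_2 + 1\\ &\quad +e_0(e_1e_2e_3f_1f_3 - e_1e_2e_3f_0f_2 - e_1f_1f_2f_3 + e_3f_0f_1f_2 + e_2f_0f_1 - e_2f_2f_3 + e_1f_0 - e_3f_3), \\ q_0 &=e_0(e_1e_3f_1f_2 + e_1e_2f_1 + e_2e_3f_2 -1)+ f_3(e_1e_2e_3f_1 - e_1f_1f_2 - e_2f_2 - e_3). \end{aligned}$$ 1. Let $K$ be $\mathbb R$ or $\mathbb C$, $e_i,f_i\in K$, and let $a_0,\dots,a_4\in K$ satisfy $a_{i+1}=\frac{a_if_i+e_{i+1}}{1-a_if_ie_{i+1}}$ with non-zero denominators for $i=0,\dots,3$ (where $e_4=e_0$). Then $a_0-a_4=0$ if and only if $q_2a_0^2+q_1a_0+q_0=0$. 2. Let $K$ be $\mathbb R$ or $\mathbb C$, $e_0,f_0,\dots,f_3\in K$, and let $R_1,R_2\in K$ satisfy $$\begin{aligned} R_1^2&=e_0^2(f_0f_1 - f_2f_3)(f_0f_2 - f_1f_3) + (f_0f_1f_3 - f_2)(f_0f_2f_3 - f_1), \\ R_2^2&=e_0^2(f_0f_1f_2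 - f_3)(f_1f_2f_3 - f_0) + (f_0f_1f_2f_3 - 1)(f_1f_2 - f_0f_3). \end{aligned}$$ If the denominators below do not vanish, then for each choice of the sign, $$\begin{aligned} e_1&=\frac{e_0f_0f_2(f_1^2-1)(f_3^2-1)\pm R_1R_2}{e_0^2(f_0 f_2 - f_1 f_3) (f_0-f_1 f_2 f_3 ) + (f_0 f_3 - f_1 f_2) (f_0 f_2 f_3 - f_1)}, \\ e_2&=\frac{\mp R_1R_2}{e_0^2(f_0 f_1 - f_2 f_3) (f_0 f_2 - f_1 f_3) + (f_0 f_1 f_3 - f_2) (f_0 f_2 f_3 - f_1)}, \\ e_3&=\frac{e_0f_1f_3(f_0^2 - 1)(f_2^2 - 1)\pm R_1R_2}{e_0^2(f_0 f_2 - f_1 f_3) (f_0 f_1 f_2 - f_3)+(f_0 f_3 - f_1 f_2) (f_0 f_1 f_3 - f_2)} \end{aligned}$$ satisfy the closure equations $q_2=q_1=q_0=0$. If moreover all $f_i\neq0$, these two are the only solutions $(e_1,e_2,e_3)\in K^3$ of the closure equations among those with $e_i^2\ne-1$ for $i=0,\dots,3$ (a condition that is void over $\mathbb R$). 3. For $\lambda\in(0,\pi)$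 and $f\in\mathbb R\setminus\{0,1,-1,\cos\lambda\}$ there is exactly one $\delta\in(0,\pi)$ with $\delta\neq\lambda$ and $f=\frac{\sin\delta\pm\sin\lambda}{\sin(\delta-\lambda)}$ for one of the two signs. 4. Let $V_0,\dots,V_3$ be any skew quad, let $e_i,f_i$ be real with $f_i\ne0$ and $q_2=q_1=q_0=0$, and let $\delta_i\in(0,\pi)$, $\delta_i\ne\lambda_i$, satisfy $f_i=\frac{\sin\delta_i\pm\sin\lambda_i}{\sin(\delta_i-\lambda_i)}$ (for each $i$ with one of the signs). Then for every $\alpha_0\in\mathbb R$ there are $\alpha_1,\alpha_2,\alpha_3,\beta_0,\dots,\beta_3$ satisfying the above relations for $(e,f)$, and every building block that is a configuration with parameters $(e,f)$ (for any $W_i$, and any $s_i,t_i$ with $s_it_i<0$) is a V-hedron and continuously flexible. It is an SQ surface if and only if $\varepsilon_i+\tau_i\notin\pi\mathbb Z$ for all $i$ and each $W_i$ lies outside the plane of $V_i,P_i,Q_i$. 5. Example. Let $V_0=(5,0,0)$, $V_1=(4,3,0)$, $V_2=(1,2,2)$, $V_3=(0,0,0)$, $e_0=100$, $\delta_i=2\arctan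 d_i$ with $(d_0,d_1,d_2,d_3)=(0.3,0.15,0.2,0.25)$ and $f_i=\frac{\sin\delta_i-\sin\lambda_i}{\sin(\delta_i-\lambda_i)}$. These are admissible data (the quad is skew, $\delta_i\in(0,\pi)\setminus\{\lambda_i\}$, $f_i\neq0$), the radicands of $R_1,R_2$ are positive, and the upper sign in 2 with $R_1,R_2>0$ gives a solution of the closure equations with $$e_1=-0.86081001,\quad e_2=-5.06077939,\quad e_3=0.57043281,$$ each with an error less than $5\cdot10^{-9}$. There is a building block over this central quad, being a configuration with parameters $(e,f)$, that is an SQ surface, a V-hedron and continuously flexible. 6. In particular, continuously flexible SQ surfaces (V-hedra of $3\times3$ skew quads) exist. -/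

import Mathlib

noncomputable section

namespace SkewVHedra

/-! ### Quad meshes, skewness, V-hedra and continuous flexibility -/

/-- Euclidean three-space. -/
abbrev E3 : Type := EuclideanSpace ℝ (Fin 3)

/-- A quad surface with `m × n` faces in the combinatorics of a square grid, given by its vertices. -/
abbrev QuadMesh (m n : ℕ) : Type := Fin (m + 1) → Fin (n + 1) → E3

/-- The four corners of the face with index `(i, j)`, in cyclic order. -/
def face {m n : ℕ} (X : QuadMesh m n) (i : Fin m) (j : Fin n) : Fin 4 → E3 :=
  ![X i.castSucc j.castSucc, X i.succ j.castSucc, X i.succ j.succ, X i.castSucc j.succ]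

/-- Skew-quad (SQ) surface: every face is non-planar. -/
def IsSQSurface {m n : ℕ} (X : QuadMesh m n) : Prop :=
  ∀ i j, AffineIndependent ℝ (face X i j)

/-- V-hedron: at every inner vertex `X i₁ j₁` both pairs of opposite face angles are equal. -/
def IsVHedron {m n : ℕ} (X : QuadMesh m n) : Prop :=
  ∀ (i₀ i₁ i₂ : Fin (m + 1)) (j₀ j₁ j₂ : Fin (n + 1)),
    (i₀ : ℕ) + 1 = i₁ → (i₁ : ℕ) + 1 = i₂ → (j₀ : ℕ) + 1 = j₁ → (j₁ : ℕ) + 1 = j₂ →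
    EuclideanGeometry.angle (X i₀ j₁) (X i₁ j₁) (X i₁ j₀)
        = EuclideanGeometry.angle (X i₂ j₁) (X i₁ j₁) (X i₁ j₂) ∧
    EuclideanGeometry.angle (X i₀ j₁) (X i₁ j₁) (X i₁ j₂)
        = EuclideanGeometry.angle (X i₂ j₁) (X i₁ j₁) (X i₁ j₀)

/-- Continuous flexibility: `X` is the start of a continuous one-parameter family of meshes in
which every face moves as a rigid body (the six mutual distances of its four corners are kept),
while no two members of the family are congruent to each other. -/
def ContinuouslyFlexible {m n : ℕ} (X : QuadMesh m n) : Prop :=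
  ∃ F : ℝ → QuadMesh m n,
    ContinuousOn F (Set.Icc 0 1) ∧ F 0 = X ∧
    (∀ t ∈ Set.Icc (0 : ℝ) 1, ∀ i j, Congruent (face (F t) i j) (face X i j)) ∧
    ∀ s ∈ Set.Icc (0 : ℝ) 1, ∀ t ∈ Set.Icc (0 : ℝ) 1, s ≠ t →
      ¬ Congruent (fun v : Fin (m + 1) × Fin (n + 1) => F s v.1 v.2)
          (fun v : Fin (m + 1) × Fin (n + 1) => F t v.1 v.2)

/-- The `3 × 3` mesh with central quad `V 0, V 1, V 2, V 3`. At `V i` the remaining two edges end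
in `P i` (on the side of the face along `V (i-1) V i`) and in `Q i` (on the side of the face along
`V i V (i+1)`). So the face along `V i V (i+1)` has the corners `V i, V (i+1), P (i+1), Q i`, and
the corner face at `V i` has the corners `V i, Q i, W i, P i`. -/
def block (V P Q W : Fin 4 → E3) : QuadMesh 3 3 :=
  ![![W 0, P 0, Q 3, W 3],
    ![Q 0, V 0, V 3, P 3],
    ![P 1, V 1, V 2, Q 2],
    ![W 1, Q 1, P 2, W 2]]

/-! ### Spherical image of a closed quad

All indices `i : Fin 4` are cyclic. -/

/-- The cross product on `E3`. -/
def cross (u v : E3) : E3 := WithLp.toLp 2 (crossProduct u.ofLp v.ofLp)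

/-- The vector `c_i` from `V (i-1)` to `V i`. -/
def edgeVec (V : Fin 4 → E3) (i : Fin 4) : E3 := V i - V (i - 1)

/-- The point `C_i` of the unit sphere. -/
def sphC (V : Fin 4 → E3) (i : Fin 4) : E3 := ‖edgeVec V i‖⁻¹ • edgeVec V i

/-- The length `λ_i` of the spherical arc `C_i C_{i+1}`. -/
def lam (V : Fin 4 → E3) (i : Fin 4) : ℝ :=
  InnerProductGeometry.angle (edgeVec V i) (edgeVec V (i + 1))

/-- The torsion angle `τ_i` of the quad along its edge `V (i-1) V i`: the signed angle of the
rotation about `c_i` from the plane `[V (i-2), V (i-1), V i]` to `[V (i-1), V i, V (i+1)]`. -/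
def torsion (V : Fin 4 → E3) (i : Fin 4) : ℝ :=
  Real.sign (inner ℝ (cross (edgeVec V (i - 1)) (edgeVec V i)) (edgeVec V (i + 1))) *
    InnerProductGeometry.angle (cross (edgeVec V (i - 1)) (edgeVec V i))
      (cross (edgeVec V i) (edgeVec V (i + 1)))

/-- The unit normal of the plane `[V (i-1), V i, V (i+1)]`, in the direction of `c_i × c_{i+1}`. -/
def nrm (V : Fin 4 → E3) (i : Fin 4) : E3 :=
  ‖cross (edgeVec V i) (edgeVec V (i + 1))‖⁻¹ • cross (edgeVec V i) (edgeVec V (i + 1))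

/-- The point `A_i` of the unit sphere at spherical distance `δ` from `C_i`, such that the arc
`C_i A_i` encloses the oriented angle `α` with the arc `C_i C_{i+1}`. -/
def sphA (V : Fin 4 → E3) (i : Fin 4) (δ α : ℝ) : E3 :=
  Real.cos δ • sphC V i +
    Real.sin δ • (Real.cos α • cross (nrm V i) (sphC V i) + Real.sin α • nrm V i)

/-- The point `B_i` of the unit sphere at spherical distance `δ` from `C_{i+1}`, such that the arc
`C_{i+1} B_i` encloses the oriented angle `β` with the prolongation of the arc `C_i C_{i+1}`
beyond `C_{i+1}`. -/
def sphB (V : Fin 4 → E3) (i : Fin 4) (δ β : ℝ) : E3 :=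
  Real.cos δ • sphC V (i + 1) +
    Real.sin δ • (Real.cos β • cross (nrm V i) (sphC V (i + 1)) + Real.sin β • nrm V i)

/-- `f` is one of the two transmission coefficients `(sin δ ± sin λ) / sin (δ - λ)` of the
spherical isogram with bar lengths `λ, δ, λ, δ`. -/
def IsCoefficient (l δ f : ℝ) : Prop :=
  f = (Real.sin δ + Real.sin l) / Real.sin (δ - l) ∨
  f = (Real.sin δ - Real.sin l) / Real.sin (δ - l)

/-- The angles `α_i`, `β_i` are related by `tan (β_i / 2) = f_i * tan (α_i / 2)` (written
without denominators, so that the value `∞` is admitted) and by `α_{i+1} = β_i + ε_{i+1}` modulo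
`2π`, where `ε_{i+1} = 2 arctan e_{i+1}`. -/
def IsConfiguration (e f α β : Fin 4 → ℝ) : Prop :=
  ∀ i, Real.sin (β i / 2) * Real.cos (α i / 2) = f i * (Real.sin (α i / 2) * Real.cos (β i / 2)) ∧
    ((α (i + 1) : ℝ) : Real.Angle) = ((β i + 2 * Real.arctan (e (i + 1)) : ℝ) : Real.Angle)

/-- The block over the quad `V` whose outer edges at `V i` have the directions `A_i` and `B_i`
(with signed lengths `s i` and `t i`), and whose outermost vertices are `W i`. -/
def blockOf (V : Fin 4 → E3) (δ α β s t : Fin 4 → ℝ) (W : Fin 4 → E3) : QuadMesh 3 3 :=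
  block V (fun i => V i + s i • sphA V i (δ i) (α i))
    (fun i => V i + t i • sphB V i (δ i) (β i)) W

/-! ### The closure equations for `n = 4` and their explicit solution -/

section Algebra

variable {K : Type} [Field K]

def q₂ (e f : Fin 4 → K) : K :=
  f 0 * (e 0 * f 3 * (e 1 * e 2 * f 2 + e 2 * e 3 * f 1 + e 1 * e 3 - f 1 * f 2)
    + e 1 * e 2 * e 3 * f 2 - e 3 * f 1 * f 2 - e 2 * f 1 - e 1)

def q₁ (e f : Fin 4 → K) : K :=
  e 1 * e 2 * f 0 * f 2 * f 3 + e 2 * e 3 * f 0 * f 1 * f 3 + e 1 * e 3 * f 0 * f 3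
    - e 1 * e 3 * f 1 * f 2 - f 0 * f 1 * f 2 * f 3 - e 1 * e 2 * f 1 - e 2 * e 3 * f 2 + 1
    + e 0 * (e 1 * e 2 * e 3 * f 1 * f 3 - e 1 * e 2 * e 3 * f 0 * f 2 - e 1 * f 1 * f 2 * f 3
      + e 3 * f 0 * f 1 * f 2 + e 2 * f 0 * f 1 - e 2 * f 2 * f 3 + e 1 * f 0 - e 3 * f 3)

def q₀ (e f : Fin 4 → K) : K :=
  e 0 * (e 1 * e 3 * f 1 * f 2 + e 1 * e 2 * f 1 + e 2 * e 3 * f 2 - 1)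
    + f 3 * (e 1 * e 2 * e 3 * f 1 - e 1 * f 1 * f 2 - e 2 * f 2 - e 3)

/-- The closure equations `q₂ = q₁ = q₀ = 0`. -/
def ClosureEquations (e f : Fin 4 → K) : Prop := q₂ e f = 0 ∧ q₁ e f = 0 ∧ q₀ e f = 0

/-- The radicand of `R₁`. -/
def rad₁ (e₀ : K) (f : Fin 4 → K) : K :=
  e₀ ^ 2 * (f 0 * f 1 - f 2 * f 3) * (f 0 * f 2 - f 1 * f 3)
    + (f 0 * f 1 * f 3 - f 2) * (f 0 * f 2 * f 3 - f 1)

/-- The radicand of `R₂`. -/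
def rad₂ (e₀ : K) (f : Fin 4 → K) : K :=
  e₀ ^ 2 * (f 0 * f 1 * f 2 - f 3) * (f 1 * f 2 * f 3 - f 0)
    + (f 0 * f 1 * f 2 * f 3 - 1) * (f 1 * f 2 - f 0 * f 3)

def den₁ (e₀ : K) (f : Fin 4 → K) : K :=
  e₀ ^ 2 * (f 0 * f 2 - f 1 * f 3) * (f 0 - f 1 * f 2 * f 3)
    + (f 0 * f 3 - f 1 * f 2) * (f 0 * f 2 * f 3 - f 1)

def den₂ (e₀ : K) (f : Fin 4 → K) : K :=
  e₀ ^ 2 * (f 0 * f 1 - f 2 * f 3) * (f 0 * f 2 - f 1 * f 3)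
    + (f 0 * f 1 * f 3 - f 2) * (f 0 * f 2 * f 3 - f 1)

def den₃ (e₀ : K) (f : Fin 4 → K) : K :=
  e₀ ^ 2 * (f 0 * f 2 - f 1 * f 3) * (f 0 * f 1 * f 2 - f 3)
    + (f 0 * f 3 - f 1 * f 2) * (f 0 * f 1 * f 3 - f 2)

/-- The quadruple `(e₀, e₁, e₂, e₃)` of the explicit solution; `σ = 1` is the upper sign and
`σ = -1` the lower sign. -/
def explicitSol (e₀ : K) (f : Fin 4 → K) (R₁ R₂ σ : K) : Fin 4 → K :=
  ![e₀,
    (e₀ * f 0 * f 2 * (f 1 ^ 2 - 1) * (f 3 ^ 2 - 1) + σ * (R₁ * R₂)) / den₁ e₀ f,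
    (-(σ * (R₁ * R₂))) / den₂ e₀ f,
    (e₀ * f 1 * f 3 * (f 0 ^ 2 - 1) * (f 2 ^ 2 - 1) + σ * (R₁ * R₂)) / den₃ e₀ f]

end Algebra

/-! ### Data of the example -/

def exV : Fin 4 → E3 := ![!₂[5, 0, 0], !₂[4, 3, 0], !₂[1, 2, 2], !₂[0, 0, 0]]

/-- `δ_i = 2 arctan d_i`. -/
def exδ : Fin 4 → ℝ := fun i => 2 * Real.arctan (![0.3, 0.15, 0.2, 0.25] i)

/-- The transmission coefficients with respect to the minus sign. -/
def exf : Fin 4 → ℝ := fun i =>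
  (Real.sin (exδ i) - Real.sin (lam exV i)) / Real.sin (exδ i - lam exV i)

/-- The solution related to the upper sign. -/
def exe : Fin 4 → ℝ :=
  explicitSol 100 exf (Real.sqrt (rad₁ 100 exf)) (Real.sqrt (rad₂ 100 exf)) 1

end SkewVHedra

end

noncomputable section

namespace SkewVHedra

/-! ### The closure equations as algebra over a field, and their explicit solution. -/

section Closure
variable {K : Type} [Field K]

/-! In homogeneous coordinates `(sin (α/2), cos (α/2))` the step from `α_i` to `α_{i+1}` is the
projective map R(e_{i+1}) D(f_i), where D(f) = diag(f, 1) and R(e) has the rows (1, e) and (-e, 1).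
Let N = R(e₀)D(f₃) R(e₃)D(f₂) R(e₂)D(f₁) R(e₁)D(f₀). Its fixed points are the roots of the quadratic
with q₂ = N₂₁, q₁ = N₂₂ - N₁₁, q₀ = -N₁₂, so the closure equations say that N is a scalar matrix:
every initial angle closes up (`closure_angle_eq`).

Explicit solution. If f_i ≠ 0 and e_i² ≠ -1, all factors are invertible, and N being scalar can be
solved for R(e₃) up to scale. A matrix proportional to some R(e) has equal diagonal entries and
opposite off-diagonal ones; this gives two relations bilinear in e₁, e₂ and free of e₃. Isolating
R(e₁) gives two relations in e₂, e₃. Elimination leaves den₁e₁ = n₁ - den₂e₂, den₃e₃ = n₃ - den₂e₂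
and den₂e₂² = rad₂, where n₁, n₃ are the root-free parts of the numerators. Since den₂ and rad₁ =
R₁² are the same polynomial, R₁e₂ = ±R₂. Conversely, these relations turn each q_k, up to the factor
den₁den₃, into a cubic in e₂ divisible by den₂e₂² - rad₂.

Geometry. The transmission coefficient is chosen so that ⟨A_i, B_i⟩ = cos λ_i whenever tan(β_i/2) =
f_i tan(α_i/2) (`isogram_cos`). Together with the fixed distances δ_i this yields equal opposite
angles, and it makes the corner faces rigid. A_{i+1} and B_i have fixed distances from C_{i+1}, and
their mutual position depends only on α_{i+1} - β_i ≡ ε_{i+1}; hence the side faces are rigid too,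
with a volume proportional to sin(ε_{i+1} + τ_{i+1}). Because the closure equations leave α₀ free,
the block moves while its central quad stays fixed. Different α₀ modulo 2π give incongruent blocks,
since a point is determined by its distances from the corners of a skew quad.

Uniqueness of δ is a computation with half-angle tangents, and the example is certified by interval
arithmetic. -/

theorem closure_iff_quadratic (e f : Fin 4 → K) (a : Fin 5 → K)
    (h : ∀ i : Fin 4, 1 - a i.castSucc * f i * e (i + 1) ≠ 0 ∧
      a i.succ = (a i.castSucc * f i + e (i + 1)) / (1 - a i.castSucc * f i * e (i + 1))) :
    a 0 - a 4 = 0 ↔ q₂ e f * a 0 ^ 2 + q₁ e f * a 0 + q₀ e f = 0 := by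
  -- Each a_i is carried as one fraction whose numerator and denominator are affine in a₀.
  -- Cross-multiplying a₀ = a₄ at the end gives the quadratic itself.
  have step : ∀ {x y p q c d : K}, p ≠ 0 → x = q / p → 1 - x * c * d ≠ 0 →
      y = (x * c + d) / (1 - x * c * d) →
      p - q * c * d ≠ 0 ∧ y = (q * c + d * p) / (p - q * c * d) := by
    intro x y p q c d hp hx hd hy
    have : 1 - x * c * d = (p - q * c * d) / p := by rw [hx]; field_simp
    rw [this] at hd hy
    have hd' : p - q * c * d ≠ 0 := fun h => hd (by rw [h, zero_div])
    refine ⟨hd', ?_⟩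
    rw [hy, hx]; field_simp
  obtain ⟨d0, h0⟩ := step one_ne_zero (div_one (a 0)).symm (h 0).1 (h 0).2
  obtain ⟨d1, h1⟩ := step d0 h0 (h 1).1 (h 1).2
  obtain ⟨d2, h2⟩ := step d1 h1 (h 2).1 (h 2).2
  obtain ⟨d3, h3⟩ := step d2 h2 (h 3).1 (h 3).2
  have h4 : a 4 = _ := h3
  rw [sub_eq_zero, h4, eq_div_iff d3, ← sub_eq_zero]
  apply Eq.congr_left
  simp only [q₂, q₁, q₀, Fin.isValue, Fin.reduceAdd, zero_add]
  ring

/-- Here x, z stand for e₀, e₂ and a, …, d for f₀, …, f₃; e₁ and e₃ have been replaced by (n₁ -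
d₂z)/d₁ and (n₃ - d₂z)/d₃ and denominators cleared. The linear quotient by d₂z² - r is read off from
the coefficients of z³ and z². The next two identities have the same pattern. -/
theorem cubic_identity_q₂ (x a b c d z n₁ n₃ d₁ d₂ d₃ r : K)
    (hd₁ : d₁ = x ^ 2 * (a * c - b * d) * (a - b * c * d) + (a * d - b * c) * (a * c * d - b))
    (hd₂ : d₂ = x ^ 2 * (a * b - c * d) * (a * c - b * d) + (a * b * d - c) * (a * c * d - b))
    (hd₃ : d₃ = x ^ 2 * (a * c - b * d) * (a * b * c - d) + (a * d - b * c) * (a * b * d - c))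
    (hn₁ : n₁ = x * a * c * (b ^ 2 - 1) * (d ^ 2 - 1))
    (hn₃ : n₃ = x * b * d * (a ^ 2 - 1) * (c ^ 2 - 1))
    (hr : r = x ^ 2 * (a * b * c - d) * (b * c * d - a) + (a * b * c * d - 1) * (b * c - a * d)) :
    (-(a * x * d * b * c) - a * z * b) * d₁ * d₃ + ((-a) + (a * x * d * c) * z) * d₃ * (n₁ - d₂ * z)
        + ((-(a * b * c)) + (a * x * d * b) * z) * d₁ * (n₃ - d₂ * z)
        + ((a * x * d) + (a * c) * z) * (n₁ - d₂ * z) * (n₃ - d₂ * z)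
      = ((a * c) * d₂ * z - (a * x * d * c) * d₃ - (a * x * d * b) * d₁ + (a * x * d) * d₂
        - (a * c) * (n₁ + n₃)) * (d₂ * z ^ 2 - r) := by
  subst hd₁ hd₂ hd₃ hn₁ hn₃ hr
  ring

theorem cubic_identity_q₁ (x a b c d z n₁ n₃ d₁ d₂ d₃ r : K)
    (hd₁ : d₁ = x ^ 2 * (a * c - b * d) * (a - b * c * d) + (a * d - b * c) * (a * c * d - b))
    (hd₂ : d₂ = x ^ 2 * (a * b - c * d) * (a * c - b * d) + (a * b * d - c) * (a * c * d - b))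
    (hd₃ : d₃ = x ^ 2 * (a * c - b * d) * (a * b * c - d) + (a * d - b * c) * (a * b * d - c))
    (hn₁ : n₁ = x * a * c * (b ^ 2 - 1) * (d ^ 2 - 1))
    (hn₃ : n₃ = x * b * d * (a ^ 2 - 1) * (c ^ 2 - 1))
    (hr : r = x ^ 2 * (a * b * c - d) * (b * c * d - a) + (a * b * c * d - 1) * (b * c - a * d)) :
    (-(a * b * c * d) + 1 + x * (z * a * b - z * c * d)) * d₁ * d₃ + ((x * (a - b * c * d))
      + (a * c * d - b) * z) * d₃ * (n₁ - d₂ * z)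
        + ((x * (a * b * c - d)) + (a * b * d - c) * z) * d₁ * (n₃ - d₂ * z)
        + ((a * d - b * c) + (x * (b * d - a * c)) * z) * (n₁ - d₂ * z) * (n₃ - d₂ * z)
      = ((x * (b * d - a * c)) * d₂ * z - (a * c * d - b) * d₃ - (a * b * d - c) * d₁ + (a * d
        - b * c) * d₂ - (x * (b * d - a * c)) * (n₁ + n₃)) * (d₂ * z ^ 2 - r) := by
  subst hd₁ hd₂ hd₃ hn₁ hn₃ hr
  ring

theorem cubic_identity_q₀ (x a b c d z n₁ n₃ d₁ d₂ d₃ r : K)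
    (hd₁ : d₁ = x ^ 2 * (a * c - b * d) * (a - b * c * d) + (a * d - b * c) * (a * c * d - b))
    (hd₂ : d₂ = x ^ 2 * (a * b - c * d) * (a * c - b * d) + (a * b * d - c) * (a * c * d - b))
    (hd₃ : d₃ = x ^ 2 * (a * c - b * d) * (a * b * c - d) + (a * d - b * c) * (a * b * d - c))
    (hn₁ : n₁ = x * a * c * (b ^ 2 - 1) * (d ^ 2 - 1))
    (hn₃ : n₃ = x * b * d * (a ^ 2 - 1) * (c ^ 2 - 1))
    (hr : r = x ^ 2 * (a * b * c - d) * (b * c * d - a) + (a * b * c * d - 1) * (b * c - a * d)) :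
    (-x - d * z * c) * d₁ * d₃ + ((-(d * b * c)) + (x * b) * z) * d₃ * (n₁ - d₂ * z)
        + ((-d) + (x * c) * z) * d₁ * (n₃ - d₂ * z)
        + ((x * b * c) + (d * b) * z) * (n₁ - d₂ * z) * (n₃ - d₂ * z)
      = ((d * b) * d₂ * z - (x * b) * d₃ - (x * c) * d₁ + (x * b * c) * d₂ - (d * b) * (n₁
        + n₃)) * (d₂ * z ^ 2 - r) := by
  subst hd₁ hd₂ hd₃ hn₁ hn₃ hr
  ring

/-- The closure equations follow from the relations that define the explicit solution. -/
theorem closureEquations_of_relations (e f : Fin 4 → K)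
    (d₁ : den₁ (e 0) f ≠ 0) (d₃ : den₃ (e 0) f ≠ 0)
    (h₁ : den₁ (e 0) f * e 1 =
      e 0 * f 0 * f 2 * (f 1 ^ 2 - 1) * (f 3 ^ 2 - 1) - den₂ (e 0) f * e 2)
    (h₂ : den₂ (e 0) f * e 2 ^ 2 = rad₂ (e 0) f)
    (h₃ : den₃ (e 0) f * e 3 =
      e 0 * f 1 * f 3 * (f 0 ^ 2 - 1) * (f 2 ^ 2 - 1) - den₂ (e 0) f * e 2) :
    ClosureEquations e f := by
  -- Each q_k is bilinear in x = e₁ and z = e₃, with coefficients affine in y = e₂. The coefficient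
  -- A needs no splitting: it contributes nothing to y² and y³.
  have key : ∀ A B₀ B₁ C₀ C₁ D₀ D₁ d₁ d₂ d₃ n₁ n₃ r x y z : K, d₁ ≠ 0 → d₃ ≠ 0 →
      d₁ * x = n₁ - d₂ * y → d₂ * y ^ 2 = r → d₃ * z = n₃ - d₂ * y →
      A * d₁ * d₃ + (B₀ + B₁ * y) * d₃ * (n₁ - d₂ * y)
          + (C₀ + C₁ * y) * d₁ * (n₃ - d₂ * y)
          + (D₀ + D₁ * y) * (n₁ - d₂ * y) * (n₃ - d₂ * y)
        = (D₁ * d₂ * y - B₁ * d₃ - C₁ * d₁ + D₀ * d₂ - D₁ * (n₁ + n₃)) * (d₂ * y ^ 2 - r) →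
      A + (B₀ + B₁ * y) * x + (C₀ + C₁ * y) * z + (D₀ + D₁ * y) * (x * z) = 0 := by
    intro A B₀ B₁ C₀ C₁ D₀ D₁ d₁ d₂ d₃ n₁ n₃ r x y z hd₁ hd₃ h₁ h₂ h₃ h
    rw [h₂, sub_self, mul_zero, ← h₁, ← h₃] at h
    have h' : d₁ * d₃ * (A + (B₀ + B₁ * y) * x + (C₀ + C₁ * y) * z
      + (D₀ + D₁ * y) * (x * z)) = 0 := by linear_combination h
    exact (mul_eq_zero.mp h').resolve_left (mul_ne_zero hd₁ hd₃)
  refine ⟨?_, ?_, ?_⟩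
  · have := key _ _ _ _ _ _ _ _ _ _ _ _ _ _ _ _ d₁ d₃ h₁ h₂ h₃
      (cubic_identity_q₂ (e 0) (f 0) (f 1) (f 2) (f 3) (e 2) _ _ _ _ _ _ rfl rfl rfl rfl rfl rfl)
    rw [← this, q₂]; ring
  · have := key _ _ _ _ _ _ _ _ _ _ _ _ _ _ _ _ d₁ d₃ h₁ h₂ h₃
      (cubic_identity_q₁ (e 0) (f 0) (f 1) (f 2) (f 3) (e 2) _ _ _ _ _ _ rfl rfl rfl rfl rfl rfl)
    rw [← this, q₁]; ring
  · have := key _ _ _ _ _ _ _ _ _ _ _ _ _ _ _ _ d₁ d₃ h₁ h₂ h₃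
      (cubic_identity_q₀ (e 0) (f 0) (f 1) (f 2) (f 3) (e 2) _ _ _ _ _ _ rfl rfl rfl rfl rfl rfl)
    rw [← this, q₀]; ring

/-- Since den₂ = rad₁ = R₁², the product den₂e₂ = -σR₁R₂ has the square den₂·rad₂, and the
numerators of e₁, e₃ are n₁ - den₂e₂ and n₃ - den₂e₂. -/
theorem closureEquations_explicitSol (e₀ : K) (f : Fin 4 → K) (R₁ R₂ σ : K) (hσ : σ ^ 2 = 1)
    (h₁ : R₁ ^ 2 = rad₁ e₀ f) (h₂ : R₂ ^ 2 = rad₂ e₀ f)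
    (d₁ : den₁ e₀ f ≠ 0) (d₂ : den₂ e₀ f ≠ 0) (d₃ : den₃ e₀ f ≠ 0) :
    ClosureEquations (explicitSol e₀ f R₁ R₂ σ) f := by
  have h₁' : R₁ ^ 2 = den₂ e₀ f := h₁
  apply closureEquations_of_relations
  · exact d₁
  · exact d₃
  · simp only [explicitSol, Matrix.cons_val]
    field_simp
    ring
  · simp only [explicitSol, Matrix.cons_val]
    field_simp
    rw [hσ, h₁', h₂]; ring
  · simp only [explicitSol, Matrix.cons_val]
    field_simp
    ring

/-- The product of the factors with indices `0, 1, 2` determines the remaining two. -/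
theorem bilinear_relations_of_closure (e f : Fin 4 → K) (hf : ∀ i, f i ≠ 0)
    (he : ∀ i, e i ^ 2 ≠ -1) (h : ClosureEquations e f) :
    (f 0 * f 1 * f 2 * f 3 - 1 + e 0 * (f 0 - f 1 * f 2 * f 3) * e 1
      + e 0 * (f 0 * f 1 - f 2 * f 3) * e 2 + (f 1 - f 0 * f 2 * f 3) * (e 1 * e 2) = 0) ∧
    (e 0 * (f 0 * f 1 * f 2 - f 3) + (f 1 * f 2 - f 0 * f 3) * e 1
      + (f 2 - f 0 * f 1 * f 3) * e 2 + e 0 * (f 1 * f 3 - f 0 * f 2) * (e 1 * e 2) = 0) := by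
  obtain ⟨h2, h1, h0⟩ := h
  rw [q₂] at h2
  rw [q₁] at h1
  rw [q₀] at h0
  have he' : ∀ i, 1 + e i ^ 2 ≠ 0 := fun i hi => he i (by linear_combination hi)
  -- These are the determinants of R(e₀), D(f₃), R(e₃), D(f₂), which appear when factors of N are
  -- moved to the other side by their adjugates.
  have hG : (1 + e 0 ^ 2) * f 3 * (1 + e 3 ^ 2) * f 2 ≠ 0 :=
    mul_ne_zero (mul_ne_zero (mul_ne_zero (he' 0) (hf 3)) (he' 3)) (hf 2)
  generalize e 0 = x at *
  generalize e 1 = y at *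
  generalize e 2 = z at *
  generalize e 3 = w at *
  generalize f 0 = a at *
  generalize f 1 = b at *
  generalize f 2 = c at *
  generalize f 3 = d at *
  constructor
  · refine (mul_eq_zero.mp ?_).resolve_left hG
    linear_combination (c * (-(((((-x) * d) * w + 1)) * ((-x) * d))) + (-1) * (-((-((((-x) * d)
      + (-w)) * c)) * 1))) * h0 + (c * ((-((d * w + x))) * d) + (-1) * (((d + x
        * (-w)) * c) * x)) * h2 +
      (c * ((-((d * w + x))) * ((-x) * d)) + (-1) * (((d + x * (-w)) * c) * 1)) * h1
  · refine (mul_eq_zero.mp ?_).resolve_left hG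
    linear_combination (c * (-(((((-x) * d) * w + 1)) * 1)) + 1 * (-((-((((-x) * d)
      + (-w)) * c)) * ((-x) * d)))) * h0 + (c * ((-((d * w + x))) * x) + 1 * (((d + x
        * (-w)) * c) * d)) * h2 +
      (c * ((-((d * w + x))) * 1) + 1 * (((d + x * (-w)) * c) * ((-x) * d))) * h1

/-- The companion obtained by isolating R(e₁): the inverse of the product of all other factors must
have equal diagonal and opposite off-diagonal entries. -/
theorem bilinear_relations_of_closure' (e f : Fin 4 → K) (hf : ∀ i, f i ≠ 0)
    (he : ∀ i, e i ^ 2 ≠ -1) (h : ClosureEquations e f) :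
    (1 - f 0 * f 1 * f 2 * f 3 + e 0 * (f 0 * f 1 * f 2 - f 3) * e 3
      + e 0 * (f 0 * f 1 - f 2 * f 3) * e 2 + (f 0 * f 1 * f 3 - f 2) * (e 3 * e 2) = 0) ∧
    (e 0 * (f 0 - f 1 * f 2 * f 3) + (f 0 * f 3 - f 1 * f 2) * e 3
      + (f 0 * f 2 * f 3 - f 1) * e 2 + e 0 * (f 1 * f 3 - f 0 * f 2) * (e 3 * e 2) = 0) := by
  obtain ⟨h2, h1, h0⟩ := h
  rw [q₂] at h2
  rw [q₁] at h1
  rw [q₀] at h0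
  have hG : f 0 * f 1 * (1 + e 1 ^ 2) ≠ 0 :=
    mul_ne_zero (mul_ne_zero (hf 0) (hf 1)) fun hi => he 1 (by linear_combination hi)
  generalize e 0 = x at *
  generalize e 1 = y at *
  generalize e 2 = z at *
  generalize e 3 = w at *
  generalize f 0 = a at *
  generalize f 1 = b at *
  generalize f 2 = c at *
  generalize f 3 = d at *
  constructor
  · refine (mul_eq_zero.mp ?_).resolve_left hG
    linear_combination (a * a * b * y) * h0 - (b * y) * h2 + (a * b) * h1
  · refine (mul_eq_zero.mp ?_).resolve_left hG
    linear_combination (-(a * a * b)) * h0 + b * h2 + (a * b * y) * h1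

theorem eq_explicitSol_of_closure (e : Fin 4 → K) (f : Fin 4 → K) (R₁ R₂ : K)
    (h₁ : R₁ ^ 2 = rad₁ (e 0) f) (h₂ : R₂ ^ 2 = rad₂ (e 0) f)
    (d₁ : den₁ (e 0) f ≠ 0) (d₂ : den₂ (e 0) f ≠ 0) (d₃ : den₃ (e 0) f ≠ 0)
    (hf : ∀ i, f i ≠ 0) (he : ∀ i, e i ^ 2 ≠ -1) (h : ClosureEquations e f) :
    e = explicitSol (e 0) f R₁ R₂ 1 ∨ e = explicitSol (e 0) f R₁ R₂ (-1) := by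
  have h₁' : R₁ ^ 2 = den₂ (e 0) f := h₁
  obtain ⟨l1, l2⟩ := bilinear_relations_of_closure e f hf he h
  obtain ⟨l3, l4⟩ := bilinear_relations_of_closure' e f hf he h
  -- Eliminating the product e₁e₂ between `l1` and `l2`; `r3` likewise eliminates e₃e₂.
  have r1 : den₁ (e 0) f * e 1 =
      e 0 * f 0 * f 2 * (f 1 ^ 2 - 1) * (f 3 ^ 2 - 1) - den₂ (e 0) f * e 2 := by
    rw [den₁, den₂]
    linear_combination (-(e 0 * (f 1 * f 3 - f 0 * f 2))) * l1 + (f 1 - f 0 * f 2 * f 3) * l2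
  have r3 : den₃ (e 0) f * e 3 =
      e 0 * f 1 * f 3 * (f 0 ^ 2 - 1) * (f 2 ^ 2 - 1) - den₂ (e 0) f * e 2 := by
    rw [den₃, den₂]
    linear_combination (-(e 0 * (f 1 * f 3 - f 0 * f 2))) * l3 + (f 0 * f 1 * f 3 - f 2) * l4
  -- Both `l1` and `l2` are affine in e₁; this is their resultant.
  have r2 : den₂ (e 0) f * e 2 ^ 2 = rad₂ (e 0) f := by
    rw [den₂, rad₂]
    linear_combination
      (e 0 * (f 1 * f 3 - f 0 * f 2) * e 2 + (f 1 * f 2 - f 0 * f 3)) * (-l1)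
        + (e 0 * (f 0 - f 1 * f 2 * f 3) + (f 1 - f 0 * f 2 * f 3) * e 2) * l2
  -- With den₂ = R₁², relation `r2` reads (R₁e₂)² = R₂², and the two factors are the two signs.
  have hs : (R₁ * e 2 - R₂) * (R₁ * e 2 + R₂) = 0 := by
    linear_combination r2 + e 2 ^ 2 * h₁' - h₂
  have fin : ∀ σ : K, den₂ (e 0) f * e 2 = -(σ * (R₁ * R₂)) →
      e = explicitSol (e 0) f R₁ R₂ σ := by
    intro σ hσ
    funext i
    fin_cases i
    · rfl
    · simp only [explicitSol, Fin.mk_one, Matrix.cons_val]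
      rw [eq_div_iff d₁]; linear_combination r1 - hσ
    · simp only [explicitSol, Fin.reduceFinMk, Matrix.cons_val]
      rw [eq_div_iff d₂]; linear_combination hσ
    · simp only [explicitSol, Fin.reduceFinMk, Matrix.cons_val]
      rw [eq_div_iff d₃]; linear_combination r3 - hσ
  rcases mul_eq_zero.mp hs with hs | hs
  · right
    exact fin _ (by linear_combination R₁ * hs - e 2 * h₁')
  · left
    exact fin _ (by linear_combination R₁ * hs - e 2 * h₁')

end Closure

/-! ### Transmission coefficients and uniqueness of δ. -/

section Coefficient

open Real

theorem sin_sub_ne_zero {l δ : ℝ} (hl : 0 < l) (hl' : l < π) (hδ : 0 < δ) (hδ' : δ < π)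
    (h : δ ≠ l) : sin (δ - l) ≠ 0 := by
  rcases lt_or_gt_of_ne h with h | h
  · exact (sin_neg_of_neg_of_neg_pi_lt (by linarith) (by linarith)).ne
  · exact (sin_pos_of_pos_of_lt_pi (by linarith) (by linarith)).ne'

/-- The transmission coefficients in terms of half-angle tangents. -/
theorem isCoefficient_iff {l δ f : ℝ} (hl : 0 < l) (hl' : l < π) (hδ : 0 < δ) (hδ' : δ < π)
    (h : δ ≠ l) : IsCoefficient l δ f ↔
      f * (tan (δ / 2) - tan (l / 2)) = tan (δ / 2) + tan (l / 2) ∨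
      f * (1 + tan (δ / 2) * tan (l / 2)) = 1 - tan (δ / 2) * tan (l / 2) := by
  have hs := sin_sub_ne_zero hl hl' hδ hδ' h
  have hc : cos (δ / 2) ≠ 0 := (cos_pos_of_mem_Ioo ⟨by linarith, by linarith⟩).ne'
  have hc' : cos (l / 2) ≠ 0 := (cos_pos_of_mem_Ioo ⟨by linarith, by linarith⟩).ne'
  have e1 : sin δ = 2 * sin (δ / 2) * cos (δ / 2) := by rw [← sin_two_mul]; ring_nf
  have e2 : sin l = 2 * sin (l / 2) * cos (l / 2) := by rw [← sin_two_mul]; ring_nf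
  have e3 : sin (δ - l) = 2 * (sin (δ / 2) * cos (l / 2) - cos (δ / 2) * sin (l / 2)) *
      (cos (δ / 2) * cos (l / 2) + sin (δ / 2) * sin (l / 2)) := by
    rw [← sin_sub, ← cos_sub, ← sin_two_mul]; ring_nf
  have s1 := sin_sq_add_cos_sq (δ / 2)
  have s2 := sin_sq_add_cos_sq (l / 2)
  rw [e3] at hs
  have n1 : sin (δ / 2) * cos (l / 2) - cos (δ / 2) * sin (l / 2) ≠ 0 :=
    fun h => hs (by rw [h]; ring)
  have n2 : cos (δ / 2) * cos (l / 2) + sin (δ / 2) * sin (l / 2) ≠ 0 :=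
    fun h => hs (by rw [h]; ring)
  rw [IsCoefficient, eq_div_iff (e3 ▸ hs), eq_div_iff (e3 ▸ hs), e1, e2, e3, tan_eq_sin_div_cos,
    tan_eq_sin_div_cos]
  generalize sin (δ / 2) = a at *
  generalize sin (l / 2) = b at *
  generalize cos (δ / 2) = c at *
  generalize cos (l / 2) = d at *
  refine or_congr ?_ ?_
  · have : f * (a / c - b / d) = a / c + b / d ↔ f * (a * d - c * b) = a * d + c * b := by
      field_simp
    rw [this]
    constructor
    · intro h
      apply mul_left_cancel₀ n2
      linear_combination h / 2 - a * c * s2 - b * d * s1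
    · intro h
      linear_combination 2 * (c * d + a * b) * h + 2 * a * c * s2 + 2 * b * d * s1
  · have : f * (1 + a / c * (b / d)) = 1 - a / c * (b / d) ↔ f * (c * d + a * b) = c * d
    - a * b := by
      field_simp
    rw [this]
    constructor
    · intro h
      apply mul_left_cancel₀ n1
      linear_combination h / 2 - a * c * s2 + b * d * s1
    · intro h
      linear_combination 2 * (a * d - c * b) * h + 2 * a * c * s2 - 2 * b * d * s1

theorem half_tan_inj {x y : ℝ} (hx : 0 < x) (hx' : x < π) (hy : 0 < y) (hy' : y < π)
    (h : tan (x / 2) = tan (y / 2)) : x = y := by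
  have := tan_inj_of_lt_of_lt_pi_div_two (x := x / 2) (y := y / 2) (by linarith) (by linarith)
    (by linarith) (by linarith) h
  linarith

/-- For d = tan(δ/2) and t = tan(l/2) the coefficients are (d + t)/(d - t), of modulus > 1, and (1 -
dt)/(1 + dt), of modulus < 1. So |f| decides the sign, and either equation is linear in d. -/
theorem existsUnique_delta {l f : ℝ} (hl : 0 < l) (hl' : l < π) (h1 : f ≠ 1)
    (h2 : f ≠ -1) (h3 : f ≠ cos l) :
    ∃! δ : ℝ, 0 < δ ∧ δ < π ∧ δ ≠ l ∧ IsCoefficient l δ f := by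
  set t := tan (l / 2) with ht
  have tpos : 0 < t := tan_pos_of_pos_of_lt_pi_div_two (by linarith) (by linarith)
  have hcos : cos l * (1 + t ^ 2) = 1 - t ^ 2 := by
    have hc : cos (l / 2) ≠ 0 := (cos_pos_of_mem_Ioo ⟨by linarith, by linarith⟩).ne'
    have e : cos l = 2 * cos (l / 2) ^ 2 - 1 := by rw [← cos_two_mul]; ring_nf
    rw [ht, tan_eq_sin_div_cos, e]
    field_simp
    linear_combination (2 * cos (l / 2) ^ 2) * sin_sq_add_cos_sq (l / 2)
  have h1' : f - 1 ≠ 0 := sub_ne_zero.mpr h1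
  have h2' : f + 1 ≠ 0 := fun h => h2 (by linarith)
  obtain ⟨d, dpos, dt, dsol, duniq⟩ : ∃ d : ℝ, 0 < d ∧ d ≠ t ∧
      (f * (d - t) = d + t ∨ f * (1 + d * t) = 1 - d * t) ∧
      ∀ d', 0 < d' → (f * (d' - t) = d' + t ∨ f * (1 + d' * t) = 1 - d' * t) → d' = d := by
    by_cases hf : 1 < f ^ 2
    · have hpos : 0 < (f + 1) / (f - 1) := by
        have : (f + 1) / (f - 1) = (f ^ 2 - 1) / (f - 1) ^ 2 := by field_simp; ring
        rw [this]; exact div_pos (by linarith) (by positivity)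
      refine ⟨t * ((f + 1) / (f - 1)), mul_pos tpos hpos, ?_, ?_, ?_⟩
      · intro h
        field_simp at h
        linarith
      · left; field_simp; ring
      · rintro d' hd' (h | h)
        · field_simp; linarith
        · exfalso
          have hp := mul_pos hd' tpos
          nlinarith [mul_pos hp hp]
    · have hf' : f ^ 2 < 1 := lt_of_le_of_ne (not_lt.mp hf) fun h =>
        mul_ne_zero h1' h2' (by linear_combination h)
      have hpos : 0 < (1 - f) / (1 + f) := by
        apply div_pos <;> nlinarith
      have hf1 : 1 + f ≠ 0 := by rwa [add_comm]
      refine ⟨(1 - f) / (1 + f) / t, div_pos hpos tpos, ?_, ?_, ?_⟩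
      -- The solution d = t would mean t² = (1 - f)/(1 + f), that is f = cos l.
      · intro h
        apply h3
        field_simp at h
        have : 1 + t ^ 2 ≠ 0 := by positivity
        apply mul_right_cancel₀ this
        rw [hcos]; linear_combination -h
      · right; field_simp; ring
      · rintro d' hd' (h | h)
        · exfalso
          have hsq : f ^ 2 * (d' - t) ^ 2 = (d' + t) ^ 2 := by rw [← mul_pow, h]
          nlinarith [mul_pos hd' tpos, mul_nonneg (sub_nonneg.mpr hf'.le) (sq_nonneg (d' - t))]
        · field_simp; linarith
  have hd2 : tan (2 * arctan d / 2) = d := by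
    rw [mul_div_cancel_left₀ _ two_ne_zero, tan_arctan]
  have hδ : 0 < 2 * arctan d := by have := arctan_pos.mpr dpos; linarith
  have hδ' : 2 * arctan d < π := by have := arctan_lt_pi_div_two d; linarith
  have hne : 2 * arctan d ≠ l := fun h => dt (by rw [← hd2, h])
  refine ⟨2 * arctan d, ⟨hδ, hδ', hne, ?_⟩, ?_⟩
  · rw [isCoefficient_iff hl hl' hδ hδ' hne, hd2]
    exact dsol
  · rintro δ ⟨p1, p2, p3, p4⟩
    rw [isCoefficient_iff hl hl' p1 p2 p3] at p4
    apply half_tan_inj p1 p2 hδ hδ'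
    rw [hd2]
    exact duniq _ (tan_pos_of_pos_of_lt_pi_div_two (by linarith) (by linarith)) p4

end Coefficient

/-! ### Transmissions as projective maps; continuous families of angles. -/

section HalfAngles

open Real

/-- Equality modulo 2π means sin((x - y)/2) = 0, i.e. the half-angle vectors represent the same
point of the projective line. -/
theorem angle_eq_iff_half (x y : ℝ) :
    (x : Real.Angle) = y ↔ sin (x / 2) * cos (y / 2) = cos (x / 2) * sin (y / 2) := by
  rw [Real.Angle.angle_eq_iff_two_pi_dvd_sub, ← sub_eq_zero (a := sin (x / 2) * cos (y / 2)),
    ← sin_sub, sin_eq_zero_iff]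
  refine exists_congr fun k => ?_
  constructor <;> intro h <;> linarith

/-- The half-angle relation `tan (β / 2) = f * tan (α / 2)`, without denominators. -/
def HalfTanRel (f α β : ℝ) : Prop :=
  sin (β / 2) * cos (α / 2) = f * (sin (α / 2) * cos (β / 2))

/-- The relation says that the half-angle vector of β is parallel to (f sin(α/2), cos(α/2)),
including the case tan = ∞. -/
theorem HalfTanRel.exists_scale {f α β : ℝ} (hf : f ≠ 0) (h : HalfTanRel f α β) :
    ∃ μ ≠ 0, sin (β / 2) = μ * (f * sin (α / 2)) ∧ cos (β / 2) = μ * cos (α / 2) := by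
  rw [HalfTanRel] at h
  have h1 := sin_sq_add_cos_sq (α / 2)
  have h2 := sin_sq_add_cos_sq (β / 2)
  by_cases hc : cos (α / 2) = 0
  · have hs : sin (α / 2) ≠ 0 := by
      intro hs; rw [hc, hs] at h1; norm_num at h1
    have hcb : cos (β / 2) = 0 := by
      rw [hc, mul_zero] at h
      have := (mul_eq_zero.mp h.symm).resolve_left hf
      exact (mul_eq_zero.mp this).resolve_left hs
    have hsb : sin (β / 2) ≠ 0 := by
      intro hs; rw [hcb, hs] at h2; norm_num at h2
    refine ⟨sin (β / 2) / (f * sin (α / 2)), div_ne_zero hsb (mul_ne_zero hf hs), ?_, ?_⟩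
    · field_simp
    · rw [hcb, hc, mul_zero]
  · have hcb : cos (β / 2) ≠ 0 := by
      intro hcb
      rw [hcb, mul_zero, mul_zero] at h
      have := (mul_eq_zero.mp h).resolve_right hc
      rw [this, hcb] at h2; norm_num at h2
    refine ⟨cos (β / 2) / cos (α / 2), div_ne_zero hcb hc, ?_, ?_⟩
    · field_simp; linear_combination h
    · field_simp

theorem HalfTanRel.congr {f α β α' β' : ℝ} (hf : f ≠ 0) (h : HalfTanRel f α β)
    (h' : HalfTanRel f α' β') (hα : (α : Real.Angle) = α') : (β : Real.Angle) = β' := by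
  rw [angle_eq_iff_half] at hα ⊢
  obtain ⟨μ, -, h1, h2⟩ := h.exists_scale hf
  obtain ⟨ν, -, h3, h4⟩ := h'.exists_scale hf
  rw [h1, h2, h3, h4]
  linear_combination μ * ν * f * hα

/-- A continuous solution `β` of `tan (β / 2) = f * tan (α / 2)` for `0 < f`. -/
def liftPos (f α : ℝ) : ℝ :=
  α + 2 * arctan ((f - 1) * (sin (α / 2) * cos (α / 2)) /
    (cos (α / 2) ^ 2 + f * sin (α / 2) ^ 2))

theorem liftPos_denominator_pos {f : ℝ} (hf : 0 < f) (α : ℝ) :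
    0 < cos (α / 2) ^ 2 + f * sin (α / 2) ^ 2 := by
  by_cases hc : cos (α / 2) = 0
  · have := sin_sq_add_cos_sq (α / 2)
    rw [hc] at this ⊢
    nlinarith
  · positivity

/-- The argument of the arctangent is tan(β/2 - α/2) = (f - 1)t/(1 + ft²) for t = tan(α/2),
multiplied through by cos²(α/2) so that it makes sense for every α. -/
theorem halfTanRel_liftPos {f : ℝ} (hf : 0 < f) (α : ℝ) : HalfTanRel f α (liftPos f α) := by
  have hp := (liftPos_denominator_pos hf α).ne'
  set r := (f - 1) * (sin (α / 2) * cos (α / 2)) /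
    (cos (α / 2) ^ 2 + f * sin (α / 2) ^ 2) with hr
  have hr' : r * (cos (α / 2) ^ 2 + f * sin (α / 2) ^ 2) =
      (f - 1) * (sin (α / 2) * cos (α / 2)) := by rw [hr]; field_simp
  have e : liftPos f α / 2 = α / 2 + arctan r := by rw [liftPos]; ring
  have es : sin (arctan r) = r * cos (arctan r) := by
    have := tan_mul_cos (cos_arctan_pos r).ne'
    rwa [tan_arctan, eq_comm] at this
  rw [HalfTanRel, e, sin_add, cos_add, es]
  linear_combination cos (arctan r) * hr'

theorem continuous_liftPos {f : ℝ} (hf : 0 < f) : Continuous (liftPos f) := by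
  unfold liftPos
  refine continuous_id.add (continuous_const.mul (continuous_arctan.comp ?_))
  exact Continuous.div (by fun_prop) (by fun_prop) fun α => (liftPos_denominator_pos hf α).ne'

/-- The reflection β ↦ -β changes the sign of f, which reduces negative f to `liftPos`. -/
theorem exists_continuous_halfTanRel {f : ℝ} (hf : f ≠ 0) :
    ∃ φ : ℝ → ℝ, Continuous φ ∧ ∀ α, HalfTanRel f α (φ α) := by
  rcases lt_or_gt_of_ne hf with hf | hf
  · have hf' : 0 < -f := by linarith
    refine ⟨fun α => -liftPos (-f) α, (continuous_liftPos hf').neg, fun α => ?_⟩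
    have := halfTanRel_liftPos hf' α
    rw [HalfTanRel] at this ⊢
    rw [neg_div, sin_neg, cos_neg]
    linear_combination -this
  · exact ⟨_, continuous_liftPos hf, halfTanRel_liftPos hf⟩

/-- One transmission with its shift is the matrix R(e)D(f). Its determinant f(1 + e²) is non-zero,
so the image vector and with it the scale μ cannot vanish. -/
theorem exists_scale_step {f e α β α' : ℝ} (hf : f ≠ 0) (h : HalfTanRel f α β)
    (h' : (α' : Real.Angle) = ((β + 2 * arctan e : ℝ) : Real.Angle)) :
    ∃ μ ≠ 0, μ * sin (α' / 2) = f * sin (α / 2) + e * cos (α / 2) ∧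
      μ * cos (α' / 2) = cos (α / 2) - e * (f * sin (α / 2)) := by
  obtain ⟨μ, hμ, h1, h2⟩ := h.exists_scale hf
  rw [angle_eq_iff_half] at h'
  have es : sin (arctan e) = e * cos (arctan e) := by
    have := tan_mul_cos (cos_arctan_pos e).ne'
    rwa [tan_arctan, eq_comm] at this
  have hc := (cos_arctan_pos e).ne'
  have e2 : (β + 2 * arctan e) / 2 = β / 2 + arctan e := by ring
  rw [e2, sin_add, cos_add, es, h1, h2] at h'
  have h0 := sin_sq_add_cos_sq (α' / 2)
  have h3 : sin (α' / 2) * (cos (α / 2) - e * (f * sin (α / 2))) =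
      cos (α' / 2) * (f * sin (α / 2) + e * cos (α / 2)) := by
    apply mul_left_cancel₀ (mul_ne_zero hμ hc)
    linear_combination h'
  refine ⟨sin (α' / 2) * (f * sin (α / 2) + e * cos (α / 2)) +
    cos (α' / 2) * (cos (α / 2) - e * (f * sin (α / 2))), ?_, ?_, ?_⟩
  · intro hz
    have p1 : cos (α / 2) - e * (f * sin (α / 2)) = 0 := by
      linear_combination cos (α' / 2) * hz + sin (α' / 2) * h3
        - (cos (α / 2) - e * (f * sin (α / 2))) * h0
    have p2 : f * sin (α / 2) + e * cos (α / 2) = 0 := by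
      linear_combination sin (α' / 2) * hz - cos (α' / 2) * h3
        - (f * sin (α / 2) + e * cos (α / 2)) * h0
    have p3 : cos (α / 2) * (1 + e ^ 2) = 0 := by linear_combination p1 + e * p2
    have p4 : cos (α / 2) = 0 := (mul_eq_zero.mp p3).resolve_right (by positivity)
    rw [p4, mul_zero, add_zero] at p2
    have p5 := (mul_eq_zero.mp p2).resolve_left hf
    have := sin_sq_add_cos_sq (α / 2)
    rw [p4, p5] at this
    norm_num at this
  · linear_combination (f * sin (α / 2) + e * cos (α / 2)) * h0 + cos (α' / 2) * h3
  · linear_combination (cos (α / 2) - e * (f * sin (α / 2))) * h0 - sin (α' / 2) * h3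

/-- Under the closure equations, the composition of the four transmissions is the identity. -/
theorem closure_angle_eq {e f : Fin 4 → ℝ} (hf : ∀ i, f i ≠ 0) (h : ClosureEquations e f)
    {α β : Fin 4 → ℝ} {α' : ℝ} (hr : ∀ i, HalfTanRel (f i) (α i) (β i))
    (h0 : (α 1 : Real.Angle) = ((β 0 + 2 * arctan (e 1) : ℝ) : Real.Angle))
    (h1 : (α 2 : Real.Angle) = ((β 1 + 2 * arctan (e 2) : ℝ) : Real.Angle))
    (h2 : (α 3 : Real.Angle) = ((β 2 + 2 * arctan (e 3) : ℝ) : Real.Angle))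
    (h3 : (α' : Real.Angle) = ((β 3 + 2 * arctan (e 0) : ℝ) : Real.Angle)) :
    (α 0 : Real.Angle) = α' := by
  obtain ⟨μ0, m0, s0, c0⟩ := exists_scale_step (hf 0) (hr 0) h0
  obtain ⟨μ1, m1, s1, c1⟩ := exists_scale_step (hf 1) (hr 1) h1
  obtain ⟨μ2, m2, s2, c2⟩ := exists_scale_step (hf 2) (hr 2) h2
  obtain ⟨μ3, m3, s3, c3⟩ := exists_scale_step (hf 3) (hr 3) h3
  obtain ⟨e2, e1, e0⟩ := h
  rw [q₂] at e2
  rw [q₁] at e1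
  rw [q₀] at e0
  rw [angle_eq_iff_half]
  apply mul_left_cancel₀ (mul_ne_zero (mul_ne_zero (mul_ne_zero m0 m1) m2) m3)
  generalize sin (α 0 / 2) = x0 at *
  generalize cos (α 0 / 2) = y0 at *
  generalize sin (α 1 / 2) = x1 at *
  generalize cos (α 1 / 2) = y1 at *
  generalize sin (α 2 / 2) = x2 at *
  generalize cos (α 2 / 2) = y2 at *
  generalize sin (α 3 / 2) = x3 at *
  generalize cos (α 3 / 2) = y3 at *
  generalize sin (α' / 2) = x4 at *
  generalize cos (α' / 2) = y4 at *
  have t2 : μ1 * μ0 * x2 = f 1 * (f 0 * x0 + e 1 * y0) + e 2 * (y0 - e 1 * (f 0 * x0)) := by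
    linear_combination μ0 * s1 + f 1 * s0 + e 2 * c0
  have u2 : μ1 * μ0 * y2 = (y0 - e 1 * (f 0 * x0)) - e 2 * (f 1 * (f 0 * x0 + e 1 * y0)) := by
    linear_combination μ0 * c1 - e 2 * f 1 * s0 + c0
  generalize hX2 : f 1 * (f 0 * x0 + e 1 * y0) + e 2 * (y0 - e 1 * (f 0 * x0)) = X2 at *
  generalize hY2 : (y0 - e 1 * (f 0 * x0)) - e 2 * (f 1 * (f 0 * x0 + e 1 * y0)) = Y2 at *
  have t3 : μ2 * (μ1 * μ0) * x3 = f 2 * X2 + e 3 * Y2 := by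
    linear_combination μ1 * μ0 * s2 + f 2 * t2 + e 3 * u2
  have u3 : μ2 * (μ1 * μ0) * y3 = Y2 - e 3 * (f 2 * X2) := by
    linear_combination μ1 * μ0 * c2 - e 3 * f 2 * t2 + u2
  generalize hX3 : f 2 * X2 + e 3 * Y2 = X3 at *
  generalize hY3 : Y2 - e 3 * (f 2 * X2) = Y3 at *
  have t4 : μ3 * (μ2 * (μ1 * μ0)) * x4 = f 3 * X3 + e 0 * Y3 := by
    linear_combination μ2 * (μ1 * μ0) * s3 + f 3 * t3 + e 0 * u3
  have u4 : μ3 * (μ2 * (μ1 * μ0)) * y4 = Y3 - e 0 * (f 3 * X3) := by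
    linear_combination μ2 * (μ1 * μ0) * c3 - e 0 * f 3 * t3 + u3
  -- The difference of the sides is the quadratic form q₂x₀² + q₁x₀y₀ + q₀y₀².
  have key : x0 * (Y3 - e 0 * (f 3 * X3)) = y0 * (f 3 * X3 + e 0 * Y3) := by
    rw [← hX3, ← hY3, ← hX2, ← hY2]
    linear_combination x0 ^ 2 * e2 + x0 * y0 * e1 + y0 ^ 2 * e0
  linear_combination key + x0 * u4 - y0 * t4

/-- A continuous family of configurations, parametrized by the first angle. -/
theorem exists_continuous_configuration {e f : Fin 4 → ℝ} (hf : ∀ i, f i ≠ 0)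
    (h : ClosureEquations e f) :
    ∃ α β : ℝ → Fin 4 → ℝ, Continuous α ∧ Continuous β ∧ (∀ x, α x 0 = x) ∧
      ∀ x, IsConfiguration e f (α x) (β x) := by
  choose φ hφ hrel using fun i => exists_continuous_halfTanRel (hf i)
  let a1 : ℝ → ℝ := fun x => φ 0 x + 2 * arctan (e 1)
  let a2 : ℝ → ℝ := fun x => φ 1 (a1 x) + 2 * arctan (e 2)
  let a3 : ℝ → ℝ := fun x => φ 2 (a2 x) + 2 * arctan (e 3)
  have c1 : Continuous a1 := (hφ 0).add continuous_const
  have c2 : Continuous a2 := ((hφ 1).comp c1).add continuous_const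
  have c3 : Continuous a3 := ((hφ 2).comp c2).add continuous_const
  have hα : Continuous fun x => (![x, a1 x, a2 x, a3 x] : Fin 4 → ℝ) := by
    refine continuous_pi fun i => ?_
    fin_cases i
    exacts [continuous_id, c1, c2, c3]
  refine ⟨fun x => ![x, a1 x, a2 x, a3 x], fun x i => φ i (![x, a1 x, a2 x, a3 x] i), hα,
    continuous_pi fun i => (hφ i).comp ((continuous_apply i).comp hα), fun x => rfl,
    fun x i => ⟨hrel i _, ?_⟩⟩
  -- Three of the four angle relations hold by construction; the one from index 3 back to index 0 is
  -- where closure enters.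
  have hcl := closure_angle_eq (α' := φ 3 (a3 x) + 2 * arctan (e 0)) hf h
    (α := ![x, a1 x, a2 x, a3 x]) (fun i => hrel i _) rfl rfl rfl rfl
  fin_cases i
  exacts [rfl, rfl, rfl, hcl]

theorem IsConfiguration.congr {e f α β α' β' : Fin 4 → ℝ} (hf : ∀ i, f i ≠ 0)
    (h : IsConfiguration e f α β) (h' : IsConfiguration e f α' β') (h0 : α 0 = α' 0) (i : Fin 4) :
    (α i : Real.Angle) = α' i ∧ (β i : Real.Angle) = β' i := by
  have hβ : ∀ i, (α i : Real.Angle) = α' i → (β i : Real.Angle) = β' i := fun i =>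
    HalfTanRel.congr (hf i) (h i).1 (h' i).1
  have hs : ∀ i, (α i : Real.Angle) = α' i → (α (i + 1) : Real.Angle) = α' (i + 1) := by
    intro i hi
    rw [(h i).2, (h' i).2, Real.Angle.coe_add, Real.Angle.coe_add, hβ i hi]
  have a0 : (α 0 : Real.Angle) = α' 0 := by rw [h0]
  have a1 := hs 0 a0
  have a2 := hs 1 a1
  have a3 := hs 2 a2
  have hα : ∀ i, (α i : Real.Angle) = α' i := by
    intro i; fin_cases i
    exacts [a0, a1, a2, a3]
  exact ⟨hα i, hβ i (hα i)⟩

end HalfAngles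

/-! ### Cross products, volumes and congruence via Gram matrices. -/

section Cross

theorem inner_eq (u v : E3) : inner ℝ u v = u 0 * v 0 + u 1 * v 1 + u 2 * v 2 := by
  simp [PiLp.inner_apply, Fin.sum_univ_three]
  ring

theorem cross_apply_zero (u v : E3) : cross u v 0 = u 1 * v 2 - u 2 * v 1 := by
  simp [cross, crossProduct]

theorem cross_apply_one (u v : E3) : cross u v 1 = u 2 * v 0 - u 0 * v 2 := by
  simp [cross, crossProduct]

theorem cross_apply_two (u v : E3) : cross u v 2 = u 0 * v 1 - u 1 * v 0 := by
  simp [cross, crossProduct]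

theorem e3_ext {u v : E3} (h0 : u 0 = v 0) (h1 : u 1 = v 1) (h2 : u 2 = v 2) : u = v := by
  ext i
  fin_cases i
  exacts [h0, h1, h2]

theorem inner_cross_cross (a b c d : E3) :
    inner ℝ (cross a b) (cross c d) =
      inner ℝ a c * inner ℝ b d - inner ℝ a d * inner ℝ b c := by
  simp only [inner_eq, cross_apply_zero, cross_apply_one, cross_apply_two]
  ring

theorem inner_cross_left (a b : E3) : inner ℝ (cross a b) a = 0 := by
  simp only [inner_eq, cross_apply_zero, cross_apply_one, cross_apply_two]
  ring

theorem inner_cross_right (a b : E3) : inner ℝ (cross a b) b = 0 := by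
  simp only [inner_eq, cross_apply_zero, cross_apply_one, cross_apply_two]
  ring

theorem cross_swap (a b : E3) : cross b a = -cross a b := by
  apply e3_ext <;>
    simp only [PiLp.neg_apply, cross_apply_zero, cross_apply_one, cross_apply_two] <;> ring

theorem inner_cross_rotate (a b c : E3) : inner ℝ (cross a b) c = inner ℝ (cross b c) a := by
  simp only [inner_eq, cross_apply_zero, cross_apply_one, cross_apply_two]
  ring

theorem cross_smul_left (r : ℝ) (a b : E3) : cross (r • a) b = r • cross a b := by
  apply e3_ext <;>
    simp only [PiLp.smul_apply, smul_eq_mul, cross_apply_zero, cross_apply_one,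
      cross_apply_two] <;> ring

theorem cross_smul_right (r : ℝ) (a b : E3) : cross a (r • b) = r • cross a b := by
  apply e3_ext <;>
    simp only [PiLp.smul_apply, smul_eq_mul, cross_apply_zero, cross_apply_one,
      cross_apply_two] <;> ring

theorem cross_add_right (a b c : E3) : cross a (b + c) = cross a b + cross a c := by
  apply e3_ext <;>
    simp only [PiLp.add_apply, cross_apply_zero, cross_apply_one, cross_apply_two] <;> ring

theorem cross_cross_left (a b c : E3) :
    cross (cross a b) c = inner ℝ a c • b - inner ℝ b c • a := by
  apply e3_ext <;>
    simp only [PiLp.sub_apply, PiLp.smul_apply, smul_eq_mul, inner_eq, cross_apply_zero,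
      cross_apply_one, cross_apply_two] <;> ring

theorem cross_cross_cross (a b c : E3) :
    cross (cross a b) (cross b c) = inner ℝ (cross a b) c • b := by
  apply e3_ext <;>
    simp only [PiLp.smul_apply, smul_eq_mul, inner_eq, cross_apply_zero,
      cross_apply_one, cross_apply_two] <;> ring

/-- Expansion of a vector with respect to `a`, `b` and `cross a b`. -/
theorem cross_basis_expansion (a b w : E3) :
    (inner ℝ a a * inner ℝ b b - inner ℝ a b ^ 2) • w =
      (inner ℝ w a * inner ℝ b b - inner ℝ w b * inner ℝ a b) • a +
      (inner ℝ w b * inner ℝ a a - inner ℝ w a * inner ℝ a b) • b +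
      inner ℝ w (cross a b) • cross a b := by
  apply e3_ext <;>
    simp only [PiLp.add_apply, PiLp.smul_apply, smul_eq_mul, inner_eq, cross_apply_zero,
      cross_apply_one, cross_apply_two] <;> ring

theorem Continuous.cross {X : Type*} [TopologicalSpace X] {f g : X → E3} (hf : Continuous f)
    (hg : Continuous g) : Continuous fun x => SkewVHedra.cross (f x) (g x) := by
  have hf' : ∀ i, Continuous fun x => f x i := fun i => by fun_prop
  have hg' : ∀ i, Continuous fun x => g x i := fun i => by fun_prop
  rw [(PiLp.homeomorph 2 fun _ : Fin 3 => ℝ).isInducing.continuous_iff]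
  refine continuous_pi fun i => ?_
  fin_cases i
  · exact ((hf' 1).mul (hg' 2)).sub ((hf' 2).mul (hg' 1)) |>.congr fun x =>
      (cross_apply_zero _ _).symm
  · exact ((hf' 2).mul (hg' 0)).sub ((hf' 0).mul (hg' 2)) |>.congr fun x =>
      (cross_apply_one _ _).symm
  · exact ((hf' 0).mul (hg' 1)).sub ((hf' 1).mul (hg' 0)) |>.congr fun x =>
      (cross_apply_two _ _).symm

/-- The oriented volume of the parallelepiped spanned by four points. -/
def tetVol (a b c d : E3) : ℝ := inner ℝ (cross (b - a) (c - a)) (d - a)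

/-- The triple product is the determinant of the matrix with rows v₀, v₁, v₂. -/
theorem linearIndependent_iff_inner_cross (v : Fin 3 → E3) :
    LinearIndependent ℝ v ↔ inner ℝ (cross (v 0) (v 1)) (v 2) ≠ 0 := by
  have hdet : (Matrix.of fun i j => v i j).det = inner ℝ (cross (v 0) (v 1)) (v 2) := by
    rw [Matrix.det_fin_three]
    simp only [inner_eq, cross_apply_zero, cross_apply_one, cross_apply_two, Matrix.of_apply]
    ring
  rw [← hdet, ← isUnit_iff_ne_zero, ← Matrix.isUnit_iff_isUnit_det,
    ← Matrix.linearIndependent_rows_iff_isUnit]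
  exact (LinearMap.linearIndependent_iff
    (WithLp.linearEquiv 2 ℝ (Fin 3 → ℝ)).toLinearMap (by simp)).symm

theorem affineIndependent_iff_tetVol (p : Fin 4 → E3) :
    AffineIndependent ℝ p ↔ tetVol (p 0) (p 1) (p 2) (p 3) ≠ 0 := by
  rw [affineIndependent_iff_linearIndependent_vsub ℝ p 0,
    ← linearIndependent_equiv (finSuccAboveEquiv (0 : Fin 4)),
    linearIndependent_iff_inner_cross]
  rfl

/-- Points with the same coordinates with respect to vectors with equal Gram matrices. -/
theorem congruent_of_gram {ι κ : Type*} [Fintype κ] (p p' : E3) (v v' : κ → E3)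
    (h : ∀ j k, inner ℝ (v j) (v k) = inner ℝ (v' j) (v' k)) (x : ι → κ → ℝ) :
    Congruent (fun i => p + ∑ j, x i j • v j) (fun i => p' + ∑ j, x i j • v' j) := by
  rw [congruent_iff_dist_eq]
  intro i j
  have key : ∀ (q : E3) (w : κ → E3),
      dist (q + ∑ k, x i k • w k) (q + ∑ k, x j k • w k) ^ 2 =
        ∑ k, ∑ l, (x i k - x j k) * ((x i l - x j l) * inner ℝ (w k) (w l)) := by
    intro q w
    rw [dist_add_left, dist_eq_norm, ← Finset.sum_sub_distrib, ← real_inner_self_eq_norm_sq]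
    simp_rw [← sub_smul, sum_inner, inner_sum, real_inner_smul_left, real_inner_smul_right]
  rw [← sq_eq_sq₀ dist_nonneg dist_nonneg, key, key]
  simp_rw [h]

end Cross

/-! ### Polar coordinates on the sphere and the spherical isogram. -/

section Spherical

open Real

/-- The point at spherical distance `δ` from `C` in the direction that makes the angle `α` with
`n × C`, in the plane spanned by `n × C` and `n`. -/
def polarPoint (C n : E3) (δ α : ℝ) : E3 :=
  cos δ • C + sin δ • (cos α • cross n C + sin α • n)

theorem sphA_eq (V : Fin 4 → E3) (i : Fin 4) (δ α : ℝ) :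
    sphA V i δ α = polarPoint (sphC V i) (nrm V i) δ α := rfl

theorem sphB_eq (V : Fin 4 → E3) (i : Fin 4) (δ β : ℝ) :
    sphB V i δ β = polarPoint (sphC V (i + 1)) (nrm V i) δ β := rfl

theorem polarPoint_congr (C n : E3) (δ : ℝ) {α α' : ℝ} (h : (α : Real.Angle) = α') :
    polarPoint C n δ α = polarPoint C n δ α' := by
  rw [polarPoint, polarPoint, ← Real.Angle.cos_coe α, ← Real.Angle.sin_coe α, h,
    Real.Angle.cos_coe, Real.Angle.sin_coe]

theorem continuous_polarPoint (C n : E3) (δ : ℝ) : Continuous (polarPoint C n δ) := by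
  unfold polarPoint
  fun_prop

theorem inner_cross_self_swap (a b c : E3) : inner ℝ a (cross b c) = -inner ℝ (cross b a) c := by
  simp only [inner_eq, cross_apply_zero, cross_apply_one, cross_apply_two]
  ring

theorem inner_polarPoint_self {C n : E3} (hC : inner ℝ C C = 1) (hn : inner ℝ n n = 1)
    (hnC : inner ℝ n C = 0) (δ α : ℝ) :
    inner ℝ (polarPoint C n δ α) (polarPoint C n δ α) = 1 := by
  have e1 : inner ℝ (cross n C) (cross n C) = 1 := by
    rw [inner_cross_cross, hC, hn, hnC]; ring
  have e2 := inner_cross_left n C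
  have e3 := inner_cross_right n C
  simp only [polarPoint, inner_add_left, inner_add_right, real_inner_smul_left,
    real_inner_smul_right, e1, e2, e3, hC, hn, hnC, real_inner_comm (cross n C) n,
    real_inner_comm (cross n C) C, real_inner_comm n C]
  linear_combination sin_sq_add_cos_sq δ + sin δ ^ 2 * sin_sq_add_cos_sq α

theorem inner_polarPoint_left {C n : E3} (hC : inner ℝ C C = 1)
    (hnC : inner ℝ n C = 0) (δ α : ℝ) : inner ℝ (polarPoint C n δ α) C = cos δ := by
  have e3 := inner_cross_right n C
  simp only [polarPoint, inner_add_left, real_inner_smul_left, e3, hC, hnC]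
  ring

/-- Polar points with respect to the same normal and two centers. -/
theorem inner_polarPoint_same_normal {C C' n : E3} (hn : inner ℝ n n = 1)
    (hnC : inner ℝ n C = 0) (hnC' : inner ℝ n C' = 0) (δ α β : ℝ) :
    inner ℝ (polarPoint C n δ α) (polarPoint C' n δ β) =
      cos δ ^ 2 * inner ℝ C C' + sin δ * cos δ * inner ℝ (cross n C) C' * (cos α - cos β)
      + sin δ ^ 2 * (cos α * cos β * inner ℝ C C' + sin α * sin β) := by
  have e1 : inner ℝ (cross n C) (cross n C') = inner ℝ C C' := by
    rw [inner_cross_cross, hn, hnC', real_inner_comm n C, hnC]; ring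
  have e2 := inner_cross_left n C
  have e3 := inner_cross_left n C'
  have e4 := inner_cross_self_swap C n C'
  simp only [polarPoint, inner_add_left, inner_add_right, real_inner_smul_left,
    real_inner_smul_right, e1, e2, e4, hn, hnC', real_inner_comm (cross n C') n, e3,
    real_inner_comm n C, hnC]
  ring

/-- Polar points with respect to the same center and two normals. -/
theorem inner_polarPoint_same_center {C n n' : E3} (hC : inner ℝ C C = 1)
    (hnC : inner ℝ n C = 0) (hnC' : inner ℝ n' C = 0) (δ δ' α α' : ℝ) :
    inner ℝ (polarPoint C n δ α) (polarPoint C n' δ' α') =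
      cos δ * cos δ' + sin δ * sin δ' *
        (inner ℝ n n' * cos (α - α') - inner ℝ (cross n C) n' * sin (α - α')) := by
  have e1 : inner ℝ (cross n C) (cross n' C) = inner ℝ n n' := by
    rw [inner_cross_cross, hC, hnC]; ring
  have e2 := inner_cross_right n C
  have e3 := inner_cross_right n' C
  have e4 : inner ℝ n (cross n' C) = -inner ℝ (cross n C) n' := by
    simp only [inner_eq, cross_apply_zero, cross_apply_one, cross_apply_two]; ring
  simp only [polarPoint, inner_add_left, inner_add_right, real_inner_smul_left,
    real_inner_smul_right, e1, e2, e4, hC, real_inner_comm (cross n' C) C, e3, hnC,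
    real_inner_comm n' C, hnC', cos_sub, sin_sub]
  ring

/-- Crossing with C removes the component along C and turns the tangential part by a quarter turn.
This triple product becomes the volume of a side face. -/
theorem inner_cross_polarPoint {C n n' : E3} (hC : inner ℝ C C = 1)
    (hnC : inner ℝ n C = 0) (δ δ' α α' : ℝ) :
    inner ℝ (cross C (polarPoint C n δ α)) (polarPoint C n' δ' α') =
      sin δ * sin δ' *
        (-(inner ℝ n n' * sin (α - α')) - inner ℝ (cross n C) n' * cos (α - α')) := by
  have e0 : cross C (polarPoint C n δ α) = sin δ • (cos α • n - sin α • cross n C) := by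
    have t1 : cross C (cross n C) = n := by
      rw [cross_swap, cross_cross_left, hC, hnC]; simp
    have t2 : cross C C = 0 := by
      apply e3_ext <;> simp [cross_apply_zero, cross_apply_one, cross_apply_two, mul_comm]
    rw [polarPoint, cross_add_right, cross_smul_right, cross_smul_right, cross_add_right,
      cross_smul_right, cross_smul_right, t1, t2, cross_swap n C]
    module
  have e1 : inner ℝ (cross n C) (cross n' C) = inner ℝ n n' := by
    rw [inner_cross_cross, hC, hnC]; ring
  have e2 := inner_cross_right n C
  have e3 := inner_cross_right n' C
  have e4 : inner ℝ n (cross n' C) = -inner ℝ (cross n C) n' := by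
    simp only [inner_eq, cross_apply_zero, cross_apply_one, cross_apply_two]; ring
  rw [e0]
  simp only [polarPoint, inner_add_right, inner_sub_left, real_inner_smul_left,
    real_inner_smul_right, e1, e2, e4, hnC, cos_sub, sin_sub]
  ring

/-- The components along n × C and n are sin δ cos α and sin δ sin α. -/
theorem polarPoint_injective {C n : E3} (hC : inner ℝ C C = 1) (hn : inner ℝ n n = 1)
    (hnC : inner ℝ n C = 0) {δ α α' : ℝ} (hδ : sin δ ≠ 0)
    (h : polarPoint C n δ α = polarPoint C n δ α') : (α : Real.Angle) = α' := by
  have e1 : inner ℝ (cross n C) (cross n C) = 1 := by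
    rw [inner_cross_cross, hC, hn, hnC]; ring
  have e2 := inner_cross_left n C
  have e3 := inner_cross_right n C
  have hin : ∀ α, inner ℝ n (polarPoint C n δ α) = sin δ * sin α := by
    intro α
    simp only [polarPoint, inner_add_right, real_inner_smul_right, hnC, hn,
      real_inner_comm (cross n C) n, e2]
    ring
  have hiu : ∀ α, inner ℝ (cross n C) (polarPoint C n δ α) = sin δ * cos α := by
    intro α
    simp only [polarPoint, inner_add_right, real_inner_smul_right, e1, e2, e3]
    ring
  apply Real.Angle.cos_sin_inj
  · apply mul_left_cancel₀ hδ
    rw [← hiu, ← hiu, h]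
  · apply mul_left_cancel₀ hδ
    rw [← hin, ← hin, h]

/-- The transmission coefficients are the roots of a quadratic equation. -/
theorem IsCoefficient.quadratic {l δ f : ℝ} (h : IsCoefficient l δ f) (hs : sin (δ - l) ≠ 0) :
    sin (δ - l) * f ^ 2 - 2 * sin δ * f + sin (δ + l) = 0 := by
  -- Hence a quarter of the discriminant is sin² l, which explains the roots (sin δ ± sin l)/sin(δ -
  -- l).
  have key : sin (δ - l) * sin (δ + l) = sin δ ^ 2 - sin l ^ 2 := by
    rw [sin_sub, sin_add]
    linear_combination sin δ ^ 2 * sin_sq_add_cos_sq l - sin l ^ 2 * sin_sq_add_cos_sq δ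
  apply mul_left_cancel₀ hs
  rcases h with h | h
  · rw [eq_div_iff hs] at h
    linear_combination (f * sin (δ - l) - sin δ + sin l) * h + key
  · rw [eq_div_iff hs] at h
    linear_combination (f * sin (δ - l) - sin δ - sin l) * h + key

/-- The fourth side of a spherical isogram. -/
theorem isogram_cos {l δ f α β : ℝ} (h : IsCoefficient l δ f) (hs : sin (δ - l) ≠ 0)
    (hr : HalfTanRel f α β) :
    cos δ ^ 2 * cos l + sin δ * cos δ * sin l * (cos α - cos β)
      + sin δ ^ 2 * (cos α * cos β * cos l + sin α * sin β) = cos l := by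
  have hq := h.quadratic hs
  rw [HalfTanRel] at hr
  rw [sin_sub, sin_add] at hq
  have a1 := sin_sq_add_cos_sq (α / 2)
  have b1 := sin_sq_add_cos_sq (β / 2)
  have d1 := sin_sq_add_cos_sq δ
  have ea : cos α = cos (α / 2) ^ 2 - sin (α / 2) ^ 2 := by rw [← cos_two_mul']; ring_nf
  have eb : cos β = cos (β / 2) ^ 2 - sin (β / 2) ^ 2 := by rw [← cos_two_mul']; ring_nf
  have fa : sin α = 2 * sin (α / 2) * cos (α / 2) := by rw [← sin_two_mul]; ring_nf
  have fb : sin β = 2 * sin (β / 2) * cos (β / 2) := by rw [← sin_two_mul]; ring_nf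
  rw [ea, eb, fa, fb]
  generalize sin (α / 2) = p at *
  generalize cos (α / 2) = q at *
  generalize sin (β / 2) = u at *
  generalize cos (β / 2) = v at *
  have g1 : (q ^ 2 - p ^ 2) - (v ^ 2 - u ^ 2) = 2 * (u ^ 2 * q ^ 2 - p ^ 2 * v ^ 2) := by
    linear_combination (v ^ 2 - u ^ 2) * a1 - (q ^ 2 - p ^ 2) * b1
  have g2 : (q ^ 2 - p ^ 2) * (v ^ 2 - u ^ 2) = 1 - 2 * (p ^ 2 * v ^ 2 + q ^ 2 * u ^ 2) := by
    linear_combination (u ^ 2 + v ^ 2) * a1 + b1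
  rw [g1, g2]
  have hd : cos δ ^ 2 = 1 - sin δ ^ 2 := by linarith
  -- In half angles the claim is the quadratic of the coefficients made homogeneous: sin(δ-l)(uq)² -
  -- 2 sin δ (uq)(pv) + sin(δ+l)(pv)² = 0, with uq = f·pv.
  linear_combination cos l * hd - 2 * sin δ * (p * v) ^ 2 * hq -
    2 * sin δ * ((sin δ * cos l - cos δ * sin l) * (u * q + f * (p * v)) - 2 * sin δ * (p * v)) * hr

end Spherical

/-! ### The spherical image of a skew quad: arcs λ and torsions τ. -/

section SkewQuad

open Real

variable {V : Fin 4 → E3}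

/-- Any three consecutive edges of the closed quad span, up to sign, the volume of its tetrahedron.
-/
theorem inner_cross_edgeVec_ne_zero (hV : AffineIndependent ℝ V) (i : Fin 4) :
    inner ℝ (cross (edgeVec V i) (edgeVec V (i + 1))) (edgeVec V (i + 2)) ≠ 0 := by
  rw [affineIndependent_iff_tetVol] at hV
  have key : inner ℝ (cross (edgeVec V i) (edgeVec V (i + 1))) (edgeVec V (i + 2)) =
      tetVol (V 0) (V 1) (V 2) (V 3) ∨
      inner ℝ (cross (edgeVec V i) (edgeVec V (i + 1))) (edgeVec V (i + 2)) =
      -tetVol (V 0) (V 1) (V 2) (V 3) := by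
    fin_cases i
    · right
      change inner ℝ (cross (V 0 - V 3) (V 1 - V 0)) (V 2 - V 1) = _
      simp only [tetVol, inner_eq, cross_apply_zero, cross_apply_one, cross_apply_two,
        PiLp.sub_apply]
      ring
    · left
      change inner ℝ (cross (V 1 - V 0) (V 2 - V 1)) (V 3 - V 2) = _
      simp only [tetVol, inner_eq, cross_apply_zero, cross_apply_one, cross_apply_two,
        PiLp.sub_apply]
      ring
    · right
      change inner ℝ (cross (V 2 - V 1) (V 3 - V 2)) (V 0 - V 3) = _
      simp only [tetVol, inner_eq, cross_apply_zero, cross_apply_one, cross_apply_two,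
        PiLp.sub_apply]
      ring
    · left
      change inner ℝ (cross (V 3 - V 2) (V 0 - V 3)) (V 1 - V 0) = _
      simp only [tetVol, inner_eq, cross_apply_zero, cross_apply_one, cross_apply_two,
        PiLp.sub_apply]
      ring
  rcases key with h | h <;> rw [h]
  · exact hV
  · exact neg_ne_zero.mpr hV

theorem cross_edgeVec_ne_zero (hV : AffineIndependent ℝ V) (i : Fin 4) :
    cross (edgeVec V i) (edgeVec V (i + 1)) ≠ 0 := fun h =>
  inner_cross_edgeVec_ne_zero hV i (by rw [h, inner_zero_left])

theorem edgeVec_ne_zero (hV : AffineIndependent ℝ V) (i : Fin 4) : edgeVec V i ≠ 0 := by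
  intro h
  apply cross_edgeVec_ne_zero hV i
  rw [h]
  apply e3_ext <;> simp [cross_apply_zero, cross_apply_one, cross_apply_two]

theorem inner_normalize_self {v : E3} (hv : v ≠ 0) : inner ℝ (‖v‖⁻¹ • v) (‖v‖⁻¹ • v) = (1 : ℝ) := by
  have := norm_ne_zero_iff.mpr hv
  rw [real_inner_smul_left, real_inner_smul_right, real_inner_self_eq_norm_sq]
  field_simp

theorem inner_sphC_self (hV : AffineIndependent ℝ V) (i : Fin 4) :
    inner ℝ (sphC V i) (sphC V i) = 1 := inner_normalize_self (edgeVec_ne_zero hV i)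

theorem inner_nrm_self (hV : AffineIndependent ℝ V) (i : Fin 4) :
    inner ℝ (nrm V i) (nrm V i) = 1 := inner_normalize_self (cross_edgeVec_ne_zero hV i)

theorem inner_nrm_sphC (V : Fin 4 → E3) (i : Fin 4) : inner ℝ (nrm V i) (sphC V i) = 0 := by
  rw [nrm, sphC, real_inner_smul_left, real_inner_smul_right, inner_cross_left]; ring

theorem inner_nrm_sphC_succ (V : Fin 4 → E3) (i : Fin 4) :
    inner ℝ (nrm V i) (sphC V (i + 1)) = 0 := by
  rw [nrm, sphC, real_inner_smul_left, real_inner_smul_right, inner_cross_right]; ring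

theorem norm_smul_sphC (hV : AffineIndependent ℝ V) (i : Fin 4) :
    ‖edgeVec V i‖ • sphC V i = edgeVec V i := by
  rw [sphC, smul_smul, mul_inv_cancel₀ (norm_ne_zero_iff.mpr (edgeVec_ne_zero hV i)), one_smul]

theorem inner_sphC_succ (V : Fin 4 → E3) (i : Fin 4) :
    inner ℝ (sphC V i) (sphC V (i + 1)) = cos (lam V i) := by
  rw [lam, InnerProductGeometry.cos_angle, sphC, sphC, real_inner_smul_left,
    real_inner_smul_right]
  field_simp

theorem norm_cross_sq (a b : E3) :
    ‖cross a b‖ ^ 2 = ‖a‖ ^ 2 * ‖b‖ ^ 2 - inner ℝ a b ^ 2 := by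
  rw [← real_inner_self_eq_norm_sq, inner_cross_cross, real_inner_self_eq_norm_sq,
    real_inner_self_eq_norm_sq, real_inner_comm a b]
  ring

theorem norm_cross (a b : E3) :
    ‖cross a b‖ = sin (InnerProductGeometry.angle a b) * (‖a‖ * ‖b‖) := by
  rw [InnerProductGeometry.sin_angle_mul_norm_mul_norm, real_inner_self_eq_norm_sq,
    real_inner_self_eq_norm_sq, ← sq, ← norm_cross_sq, Real.sqrt_sq (norm_nonneg _)]

theorem sin_lam_pos (hV : AffineIndependent ℝ V) (i : Fin 4) : 0 < sin (lam V i) := by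
  have h := norm_cross (edgeVec V i) (edgeVec V (i + 1))
  have h1 := norm_pos_iff.mpr (cross_edgeVec_ne_zero hV i)
  rw [h] at h1
  exact pos_of_mul_pos_left h1 (by positivity)

theorem lam_pos (hV : AffineIndependent ℝ V) (i : Fin 4) : 0 < lam V i := by
  refine lt_of_le_of_ne (InnerProductGeometry.angle_nonneg _ _) fun h => ?_
  have := sin_lam_pos hV i
  rw [← h, sin_zero] at this
  exact lt_irrefl _ this

theorem lam_lt_pi (hV : AffineIndependent ℝ V) (i : Fin 4) : lam V i < π := by
  refine lt_of_le_of_ne (InnerProductGeometry.angle_le_pi _ _) fun h => ?_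
  have := sin_lam_pos hV i
  rw [h, sin_pi] at this
  exact lt_irrefl _ this

theorem inner_cross_nrm_sphC (hV : AffineIndependent ℝ V) (i : Fin 4) :
    inner ℝ (cross (nrm V i) (sphC V i)) (sphC V (i + 1)) = sin (lam V i) := by
  have h := norm_cross (edgeVec V i) (edgeVec V (i + 1))
  have h1 := norm_ne_zero_iff.mpr (cross_edgeVec_ne_zero hV i)
  have h2 := norm_ne_zero_iff.mpr (edgeVec_ne_zero hV i)
  have h3 := norm_ne_zero_iff.mpr (edgeVec_ne_zero hV (i + 1))
  rw [inner_cross_rotate, sphC, sphC, nrm, cross_smul_left, cross_smul_right]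
  simp only [real_inner_smul_left, real_inner_smul_right]
  rw [real_inner_self_eq_norm_sq]
  rw [lam]
  field_simp
  linear_combination h

theorem inner_nrm_succ (V : Fin 4 → E3) (i : Fin 4) :
    inner ℝ (nrm V i) (nrm V (i + 1)) =
      cos (InnerProductGeometry.angle (cross (edgeVec V i) (edgeVec V (i + 1)))
        (cross (edgeVec V (i + 1)) (edgeVec V (i + 1 + 1)))) := by
  rw [InnerProductGeometry.cos_angle, nrm, nrm, real_inner_smul_left, real_inner_smul_right]
  field_simp

theorem sign_eq_one_or_neg_one {x : ℝ} (hx : x ≠ 0) : Real.sign x = 1 ∨ Real.sign x = -1 := by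
  rcases lt_or_gt_of_ne hx with h | h
  · exact Or.inr (Real.sign_of_neg h)
  · exact Or.inl (Real.sign_of_pos h)

theorem add_one_add_one (i : Fin 4) : i + 1 + 1 = i + 2 := by rw [add_assoc]; rfl

theorem cos_torsion (hV : AffineIndependent ℝ V) (i : Fin 4) :
    cos (torsion V (i + 1)) = inner ℝ (nrm V i) (nrm V (i + 1)) := by
  have hD := inner_cross_edgeVec_ne_zero hV i
  rw [inner_nrm_succ, torsion, add_sub_cancel_right, add_one_add_one]
  rcases sign_eq_one_or_neg_one hD with h | h <;> rw [h]
  · rw [one_mul]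
  · rw [neg_one_mul, cos_neg]

/-- The normals of two consecutive planes have a cross product along the common edge, with the
triple product as factor. The unsigned angle only sees its modulus; the sign in `torsion` restores
it. -/
theorem sin_torsion (hV : AffineIndependent ℝ V) (i : Fin 4) :
    sin (torsion V (i + 1)) =
      ‖cross (edgeVec V i) (edgeVec V (i + 1))‖⁻¹ *
        ‖cross (edgeVec V (i + 1)) (edgeVec V (i + 1 + 1))‖⁻¹ *
        (inner ℝ (cross (edgeVec V i) (edgeVec V (i + 1))) (edgeVec V (i + 2)) *
          ‖edgeVec V (i + 1)‖) := by
  have hD := inner_cross_edgeVec_ne_zero hV i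
  have h1 := norm_ne_zero_iff.mpr (cross_edgeVec_ne_zero hV i)
  have h2 := norm_ne_zero_iff.mpr (cross_edgeVec_ne_zero hV (i + 1))
  have h := norm_cross (cross (edgeVec V i) (edgeVec V (i + 1)))
    (cross (edgeVec V (i + 1)) (edgeVec V (i + 1 + 1)))
  rw [cross_cross_cross, norm_smul, Real.norm_eq_abs, add_one_add_one] at h
  rw [add_one_add_one] at h2
  rw [torsion, add_sub_cancel_right, add_one_add_one]
  rcases lt_or_gt_of_ne hD with hs | hs
  · rw [Real.sign_of_neg hs, neg_one_mul, sin_neg]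
    rw [abs_of_neg hs] at h
    field_simp
    linear_combination h
  · rw [Real.sign_of_pos hs, one_mul]
    rw [abs_of_pos hs] at h
    field_simp
    linear_combination -h

theorem inner_cross_nrm_sphC_nrm (hV : AffineIndependent ℝ V) (i : Fin 4) :
    inner ℝ (cross (nrm V i) (sphC V (i + 1))) (nrm V (i + 1)) = -sin (torsion V (i + 1)) := by
  have h3 := norm_ne_zero_iff.mpr (edgeVec_ne_zero hV (i + 1))
  rw [sin_torsion hV, nrm, nrm, sphC, cross_smul_left, cross_smul_right]
  simp only [real_inner_smul_left, real_inner_smul_right]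
  have key : inner ℝ (cross (cross (edgeVec V i) (edgeVec V (i + 1))) (edgeVec V (i + 1)))
      (cross (edgeVec V (i + 1)) (edgeVec V (i + 1 + 1))) =
      -(inner ℝ (cross (edgeVec V i) (edgeVec V (i + 1))) (edgeVec V (i + 2)) *
        ‖edgeVec V (i + 1)‖ ^ 2) := by
    rw [inner_cross_cross, inner_cross_right, real_inner_self_eq_norm_sq, add_one_add_one]
    ring
  rw [key]
  field_simp

end SkewQuad

/-! ### Combinatorics of the block, V-hedron property and skewness. -/

section Block

open Real

/-! ### Combinatorics of the `3 × 3` block -/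

/-- The faces of the block, up to a renumbering of their corners. -/
theorem face_block (i j : Fin 3) :
    (∃ σ : Equiv.Perm (Fin 4), ∀ V P Q W, face (block V P Q W) i j = V ∘ σ) ∨
    (∃ (k : Fin 4) (σ : Equiv.Perm (Fin 4)), ∀ V P Q W,
      face (block V P Q W) i j = ![V k, V (k + 1), P (k + 1), Q k] ∘ σ) ∨
    (∃ (k : Fin 4) (σ : Equiv.Perm (Fin 4)), ∀ V P Q W,
      face (block V P Q W) i j = ![V k, Q k, W k, P k] ∘ σ) := by
  fin_cases i <;> fin_cases j
  · exact Or.inr (Or.inr ⟨0, ⟨![2, 1, 0, 3], ![2, 1, 0, 3], by decide, by decide⟩, fun V P Q W => by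
      funext x; fin_cases x <;> rfl⟩)
  · exact Or.inr (Or.inl ⟨3, ⟨![2, 1, 0, 3], ![2, 1, 0, 3], by decide, by decide⟩, fun V P Q W => by
      funext x; fin_cases x <;> rfl⟩)
  · exact Or.inr (Or.inr ⟨3, ⟨![1, 0, 3, 2], ![1, 0, 3, 2], by decide, by decide⟩, fun V P Q W => by
      funext x; fin_cases x <;> rfl⟩)
  · exact Or.inr (Or.inl ⟨0, ⟨![3, 2, 1, 0], ![3, 2, 1, 0], by decide, by decide⟩, fun V P Q W => by
      funext x; fin_cases x <;> rfl⟩)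
  · exact Or.inl ⟨1, fun V P Q W => by funext x; fin_cases x <;> rfl⟩
  · exact Or.inr (Or.inl ⟨2, ⟨![1, 0, 3, 2], ![1, 0, 3, 2], by decide, by decide⟩, fun V P Q W => by
      funext x; fin_cases x <;> rfl⟩)
  · exact Or.inr (Or.inr ⟨1, ⟨![3, 2, 1, 0], ![3, 2, 1, 0], by decide, by decide⟩, fun V P Q W => by
      funext x; fin_cases x <;> rfl⟩)
  · exact Or.inr (Or.inl ⟨1, ⟨![0, 3, 2, 1], ![0, 3, 2, 1], by decide, by decide⟩, fun V P Q W => by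
      funext x; fin_cases x <;> rfl⟩)
  · exact Or.inr (Or.inr ⟨2, ⟨![0, 3, 2, 1], ![0, 3, 2, 1], by decide, by decide⟩, fun V P Q W => by
      funext x; fin_cases x <;> rfl⟩)

theorem exists_side_face (k : Fin 4) : ∃ (i j : Fin 3) (σ : Equiv.Perm (Fin 4)), ∀ V P Q W,
    face (block V P Q W) i j = ![V k, V (k + 1), P (k + 1), Q k] ∘ σ := by
  fin_cases k
  · exact ⟨1, 0, ⟨![3, 2, 1, 0], ![3, 2, 1, 0], by decide, by decide⟩, fun V P Q W => by
      funext x; fin_cases x <;> rfl⟩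
  · exact ⟨2, 1, ⟨![0, 3, 2, 1], ![0, 3, 2, 1], by decide, by decide⟩, fun V P Q W => by
      funext x; fin_cases x <;> rfl⟩
  · exact ⟨1, 2, ⟨![1, 0, 3, 2], ![1, 0, 3, 2], by decide, by decide⟩, fun V P Q W => by
      funext x; fin_cases x <;> rfl⟩
  · exact ⟨0, 1, ⟨![2, 1, 0, 3], ![2, 1, 0, 3], by decide, by decide⟩, fun V P Q W => by
      funext x; fin_cases x <;> rfl⟩

theorem exists_corner_face (k : Fin 4) : ∃ (i j : Fin 3) (σ : Equiv.Perm (Fin 4)), ∀ V P Q W,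
    face (block V P Q W) i j = ![V k, Q k, W k, P k] ∘ σ := by
  fin_cases k
  · exact ⟨0, 0, ⟨![2, 1, 0, 3], ![2, 1, 0, 3], by decide, by decide⟩, fun V P Q W => by
      funext x; fin_cases x <;> rfl⟩
  · exact ⟨2, 0, ⟨![3, 2, 1, 0], ![3, 2, 1, 0], by decide, by decide⟩, fun V P Q W => by
      funext x; fin_cases x <;> rfl⟩
  · exact ⟨2, 2, ⟨![0, 3, 2, 1], ![0, 3, 2, 1], by decide, by decide⟩, fun V P Q W => by
      funext x; fin_cases x <;> rfl⟩
  · exact ⟨0, 2, ⟨![1, 0, 3, 2], ![1, 0, 3, 2], by decide, by decide⟩, fun V P Q W => by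
      funext x; fin_cases x <;> rfl⟩

theorem isSQSurface_block_iff {V : Fin 4 → E3} (hV : AffineIndependent ℝ V) (P Q W : Fin 4 → E3) :
    IsSQSurface (block V P Q W) ↔
      (∀ k, AffineIndependent ℝ ![V k, V (k + 1), P (k + 1), Q k]) ∧
      ∀ k, AffineIndependent ℝ ![V k, Q k, W k, P k] := by
  constructor
  · intro h
    constructor
    · intro k
      obtain ⟨i, j, σ, hσ⟩ := exists_side_face k
      have := h i j
      rwa [hσ, affineIndependent_equiv] at this
    · intro k
      obtain ⟨i, j, σ, hσ⟩ := exists_corner_face k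
      have := h i j
      rwa [hσ, affineIndependent_equiv] at this
  · rintro ⟨h1, h2⟩ i j
    rcases face_block i j with ⟨σ, hσ⟩ | ⟨k, σ, hσ⟩ | ⟨k, σ, hσ⟩ <;>
      rw [hσ, affineIndependent_equiv]
    exacts [hV, h1 k, h2 k]

theorem isVHedron_block {V P Q W : Fin 4 → E3}
    (h1 : ∀ k, EuclideanGeometry.angle (P k) (V k) (Q k) =
      EuclideanGeometry.angle (V (k + 1)) (V k) (V (k - 1)))
    (h2 : ∀ k, EuclideanGeometry.angle (P k) (V k) (V (k - 1)) =
      EuclideanGeometry.angle (V (k + 1)) (V k) (Q k)) :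
    IsVHedron (block V P Q W) := by
  intro i₀ i₁ i₂ j₀ j₁ j₂ a1 a2 b1 b2
  have cc : ∀ {a b c d e f : E3}, EuclideanGeometry.angle a b c = EuclideanGeometry.angle d e f →
      EuclideanGeometry.angle c b a = EuclideanGeometry.angle f e d := fun h => by
    rw [EuclideanGeometry.angle_comm, h, EuclideanGeometry.angle_comm]
  have split : ∀ a b c : Fin 4, (a : ℕ) + 1 = b → (b : ℕ) + 1 = c →
      (a = 0 ∧ b = 1 ∧ c = 2) ∨ (a = 1 ∧ b = 2 ∧ c = 3) := by decide
  rcases split _ _ _ a1 a2 with ⟨rfl, rfl, rfl⟩ | ⟨rfl, rfl, rfl⟩ <;>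
    rcases split _ _ _ b1 b2 with ⟨rfl, rfl, rfl⟩ | ⟨rfl, rfl, rfl⟩
  -- The inner vertices occur in the order V 0, V 3, V 1, V 2. At V 3 and V 1 the grid directions
  -- exchange the two pairs of opposite angles.
  · exact ⟨h1 0, h2 0⟩
  · exact ⟨cc (h2 3).symm, cc (h1 3)⟩
  · exact ⟨cc (h2 1), cc (h1 1).symm⟩
  · exact ⟨(h1 2).symm, (h2 2).symm⟩

/-! ### Geometry of the block -/

theorem angle_eq_of_inner_norm {a b c d : E3}
    (h : inner ℝ a b * (‖c‖ * ‖d‖) = inner ℝ c d * (‖a‖ * ‖b‖))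
    (ha : a ≠ 0) (hb : b ≠ 0) (hc : c ≠ 0) (hd : d ≠ 0) :
    InnerProductGeometry.angle a b = InnerProductGeometry.angle c d := by
  have := norm_ne_zero_iff.mpr ha
  have := norm_ne_zero_iff.mpr hb
  have := norm_ne_zero_iff.mpr hc
  have := norm_ne_zero_iff.mpr hd
  unfold InnerProductGeometry.angle
  congr 1
  field_simp
  linear_combination h

theorem norm_eq_one_of_inner {v : E3} (h : inner ℝ v v = (1 : ℝ)) : ‖v‖ = 1 := by
  rw [real_inner_self_eq_norm_sq] at h
  exact (pow_eq_one_iff_of_nonneg (norm_nonneg v) two_ne_zero).mp h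

variable {V : Fin 4 → E3}

theorem inner_sphA_self (hV : AffineIndependent ℝ V) (i : Fin 4) (δ α : ℝ) :
    inner ℝ (sphA V i δ α) (sphA V i δ α) = 1 :=
  inner_polarPoint_self (inner_sphC_self hV i) (inner_nrm_self hV i) (inner_nrm_sphC V i) δ α

theorem inner_sphB_self (hV : AffineIndependent ℝ V) (i : Fin 4) (δ β : ℝ) :
    inner ℝ (sphB V i δ β) (sphB V i δ β) = 1 :=
  inner_polarPoint_self (inner_sphC_self hV (i + 1)) (inner_nrm_self hV i)
    (inner_nrm_sphC_succ V i) δ β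

theorem inner_sphA_sphC (hV : AffineIndependent ℝ V) (i : Fin 4) (δ α : ℝ) :
    inner ℝ (sphA V i δ α) (sphC V i) = cos δ :=
  inner_polarPoint_left (inner_sphC_self hV i) (inner_nrm_sphC V i) δ α

theorem inner_sphB_sphC (hV : AffineIndependent ℝ V) (i : Fin 4) (δ β : ℝ) :
    inner ℝ (sphB V i δ β) (sphC V (i + 1)) = cos δ :=
  inner_polarPoint_left (inner_sphC_self hV (i + 1)) (inner_nrm_sphC_succ V i) δ β

theorem inner_sphA_sphB (hV : AffineIndependent ℝ V) (i : Fin 4) {δ f α β : ℝ}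
    (hδ : 0 < δ ∧ δ < π ∧ δ ≠ lam V i ∧ IsCoefficient (lam V i) δ f) (hr : HalfTanRel f α β) :
    inner ℝ (sphA V i δ α) (sphB V i δ β) = cos (lam V i) := by
  obtain ⟨h1, h2, h3, h4⟩ := hδ
  rw [sphA_eq, sphB_eq, inner_polarPoint_same_normal (inner_nrm_self hV i) (inner_nrm_sphC V i)
    (inner_nrm_sphC_succ V i), inner_sphC_succ, inner_cross_nrm_sphC hV]
  exact isogram_cos h4 (sin_sub_ne_zero (lam_pos hV i) (lam_lt_pi hV i) h1 h2 h3) hr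

/-- Both points are polar points about C_{i+1}, so only α - β enters; this makes the side faces
rigid. -/
theorem inner_sphA_succ_sphB (hV : AffineIndependent ℝ V) (i : Fin 4) (δ δ' α β : ℝ) :
    inner ℝ (sphA V (i + 1) δ α) (sphB V i δ' β) =
      cos δ * cos δ' + sin δ * sin δ' * (inner ℝ (nrm V (i + 1)) (nrm V i) * cos (α - β) -
        inner ℝ (cross (nrm V (i + 1)) (sphC V (i + 1))) (nrm V i) * sin (α - β)) :=
  inner_polarPoint_same_center (inner_sphC_self hV (i + 1)) (inner_nrm_sphC V (i + 1))
    (inner_nrm_sphC_succ V i) δ δ' α β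

theorem inner_cross_sphA_sphB (hV : AffineIndependent ℝ V) (i : Fin 4) (δ δ' α β : ℝ) :
    inner ℝ (cross (sphC V (i + 1)) (sphA V (i + 1) δ α)) (sphB V i δ' β) =
      -(sin δ * sin δ' * sin (α - β + torsion V (i + 1))) := by
  have h : inner ℝ (cross (nrm V (i + 1)) (sphC V (i + 1))) (nrm V i) =
      sin (torsion V (i + 1)) := by
    rw [← neg_inj, ← inner_cross_nrm_sphC_nrm hV]
    simp only [inner_eq, cross_apply_zero, cross_apply_one, cross_apply_two]; ring
  rw [sphA_eq, sphB_eq, inner_cross_polarPoint (inner_sphC_self hV (i + 1))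
    (inner_nrm_sphC V (i + 1)), h, real_inner_comm, ← cos_torsion hV, sin_add]
  ring

theorem sub_edge (V : Fin 4 → E3) (k : Fin 4) : V (k + 1) - V k = edgeVec V (k + 1) := by
  rw [edgeVec, add_sub_cancel_right]

/-- Because s and t have opposite signs, the outer angle at V_k has cosine -⟨A_k, B_k⟩ = -cos λ_k,
like the angle of the central quad between c_{k+1} and -c_k. The other two angles have the cosines
-sign(s) cos δ_k and sign(t) cos δ_k, which agree. -/
theorem isVHedron_blockOf (hV : AffineIndependent ℝ V) {e f δ α β s t : Fin 4 → ℝ}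
    (hδ : ∀ i, 0 < δ i ∧ δ i < π ∧ δ i ≠ lam V i ∧ IsCoefficient (lam V i) (δ i) (f i))
    (hc : IsConfiguration e f α β) (hst : ∀ i, s i * t i < 0) (W : Fin 4 → E3) :
    IsVHedron (blockOf V δ α β s t W) := by
  have n0 : ∀ {v : E3}, inner ℝ v v = (1 : ℝ) → v ≠ 0 := fun h hv => by
    rw [hv, inner_zero_left] at h; exact zero_ne_one h
  apply isVHedron_block <;> intro k <;> simp only [EuclideanGeometry.angle, vsub_eq_sub,
    add_sub_cancel_left, sub_edge]
  all_goals
    have hA := inner_sphA_self hV k (δ k) (α k)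
    have hB := inner_sphB_self hV k (δ k) (β k)
    have hs : s k ≠ 0 := fun h => by have := hst k; rw [h, zero_mul] at this; exact lt_irrefl _ this
    have ht : t k ≠ 0 := fun h => by have := hst k; rw [h, mul_zero] at this; exact lt_irrefl _ this
    have hneg : V (k - 1) - V k = -edgeVec V k := by rw [edgeVec]; abel
    have c0 := edgeVec_ne_zero hV k
    have c1 := edgeVec_ne_zero hV (k + 1)
    rw [hneg]
    apply angle_eq_of_inner_norm
    rotate_left
    · exact smul_ne_zero hs (n0 hA)
    · first | exact smul_ne_zero ht (n0 hB) | exact neg_ne_zero.mpr c0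
    · exact c1
    · first | exact smul_ne_zero ht (n0 hB) | exact neg_ne_zero.mpr c0
  · have habs : |s k| * |t k| = -(s k * t k) := by rw [← abs_mul, abs_of_neg (hst k)]
    rw [norm_smul, norm_smul, norm_eq_one_of_inner hA, norm_eq_one_of_inner hB, norm_neg,
      Real.norm_eq_abs, Real.norm_eq_abs, real_inner_smul_left, real_inner_smul_right,
      inner_sphA_sphB hV k (hδ k) (hc k).1, inner_neg_right]
    have : inner ℝ (edgeVec V (k + 1)) (edgeVec V k) =
        ‖edgeVec V (k + 1)‖ * ‖edgeVec V k‖ * cos (lam V k) := by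
      conv_lhs => rw [← norm_smul_sphC hV (k + 1), ← norm_smul_sphC hV k]
      rw [real_inner_smul_left, real_inner_smul_right, real_inner_comm, inner_sphC_succ]
      ring
    rw [this]
    linear_combination (‖edgeVec V (k + 1)‖ * ‖edgeVec V k‖ * cos (lam V k)) * habs
  · have habs : -(s k * |t k|) = t k * |s k| := by
      rcases mul_neg_iff.mp (hst k) with ⟨h, h'⟩ | ⟨h, h'⟩
      · rw [abs_of_pos h, abs_of_neg h']; ring
      · rw [abs_of_neg h, abs_of_pos h']; ring
    rw [norm_smul, norm_smul, norm_eq_one_of_inner hA, norm_eq_one_of_inner hB, norm_neg,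
      Real.norm_eq_abs, Real.norm_eq_abs, real_inner_smul_left, real_inner_smul_right,
      inner_neg_right]
    have e1 : inner ℝ (sphA V k (δ k) (α k)) (edgeVec V k) = ‖edgeVec V k‖ * cos (δ k) := by
      conv_lhs => rw [← norm_smul_sphC hV k]
      rw [real_inner_smul_right, inner_sphA_sphC hV]
    have e2 : inner ℝ (edgeVec V (k + 1)) (sphB V k (δ k) (β k)) =
        ‖edgeVec V (k + 1)‖ * cos (δ k) := by
      conv_lhs => rw [← norm_smul_sphC hV (k + 1)]
      rw [real_inner_smul_left, real_inner_comm, inner_sphB_sphC hV]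
    rw [e1, e2]
    linear_combination (‖edgeVec V (k + 1)‖ * ‖edgeVec V k‖ * cos (δ k)) * habs

/-- The volume of a side face is a non-zero multiple of sin(α_{k+1} - β_k + τ_{k+1}), and α_{k+1} -
β_k ≡ ε_{k+1}; the condition does not depend on the position of the block. -/
theorem isSQSurface_blockOf_iff (hV : AffineIndependent ℝ V) {e f δ α β s t : Fin 4 → ℝ}
    (hδ : ∀ i, 0 < δ i ∧ δ i < π)
    (hc : IsConfiguration e f α β) (hst : ∀ i, s i * t i < 0) (W : Fin 4 → E3) :
    IsSQSurface (blockOf V δ α β s t W) ↔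
      (∀ i, sin (2 * arctan (e i) + torsion V i) ≠ 0) ∧
      ∀ i, AffineIndependent ℝ
        ![V i, V i + t i • sphB V i (δ i) (β i), W i, V i + s i • sphA V i (δ i) (α i)] := by
  rw [blockOf, isSQSurface_block_iff hV]
  refine and_congr_left' ?_
  have key : ∀ k, AffineIndependent ℝ ![V k, V (k + 1),
      V (k + 1) + s (k + 1) • sphA V (k + 1) (δ (k + 1)) (α (k + 1)),
      V k + t k • sphB V k (δ k) (β k)] ↔
      sin (2 * arctan (e (k + 1)) + torsion V (k + 1)) ≠ 0 := by
    intro k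
    have hs : ∀ k, s k ≠ 0 := fun k h => by
      have := hst k; rw [h, zero_mul] at this; exact lt_irrefl _ this
    have ht : ∀ k, t k ≠ 0 := fun k h => by
      have := hst k; rw [h, mul_zero] at this; exact lt_irrefl _ this
    have hsin : ∀ k, sin (δ k) ≠ 0 := fun k => (sin_pos_of_pos_of_lt_pi (hδ k).1 (hδ k).2).ne'
    have hang : sin (α (k + 1) - β k + torsion V (k + 1)) =
        sin (2 * arctan (e (k + 1)) + torsion V (k + 1)) := by
      rw [← Real.Angle.sin_coe, Real.Angle.coe_add, Real.Angle.coe_sub, (hc k).2,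
        ← Real.Angle.coe_sub, ← Real.Angle.coe_add, Real.Angle.sin_coe]
      ring_nf
    rw [affineIndependent_iff_tetVol]
    simp only [tetVol, Matrix.cons_val, add_sub_cancel_left]
    have e1 : V (k + 1) + s (k + 1) • sphA V (k + 1) (δ (k + 1)) (α (k + 1)) - V k =
        edgeVec V (k + 1) + s (k + 1) • sphA V (k + 1) (δ (k + 1)) (α (k + 1)) := by
      rw [← sub_edge]; abel
    have e2 : cross (edgeVec V (k + 1)) (edgeVec V (k + 1)) = 0 := by
      apply e3_ext <;> simp [cross_apply_zero, cross_apply_one, cross_apply_two, mul_comm]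
    have e3 : cross (edgeVec V (k + 1)) (sphA V (k + 1) (δ (k + 1)) (α (k + 1))) =
        ‖edgeVec V (k + 1)‖ • cross (sphC V (k + 1)) (sphA V (k + 1) (δ (k + 1)) (α (k + 1))) := by
      rw [← cross_smul_left, norm_smul_sphC hV]
    rw [e1, sub_edge, cross_add_right, e2, zero_add, cross_smul_right, e3,
      real_inner_smul_left, real_inner_smul_left, real_inner_smul_right,
      inner_cross_sphA_sphB hV, hang]
    simp [hs, ht, hsin, edgeVec_ne_zero hV]
  simp_rw [key]
  exact (Equiv.addRight (1 : Fin 4)).forall_congr_left (p :=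
    fun i => sin (2 * arctan (e (i + 1)) + torsion V (i + 1)) ≠ 0) |>.trans (by simp)

end Block

/-! ### The continuous motion and the incongruence of its positions. -/

section Flexibility

open Real

variable {V : Fin 4 → E3}

theorem eq_zero_of_inner_eq_zero {a b c w : E3} (h : inner ℝ (cross a b) c ≠ 0)
    (ha : inner ℝ w a = 0) (hb : inner ℝ w b = 0) (hc : inner ℝ w c = 0) : w = 0 := by
  have key : inner ℝ (cross a b) c • w =
      inner ℝ w a • cross b c + inner ℝ w b • cross c a + inner ℝ w c • cross a b := by
    apply e3_ext <;>
      simp only [PiLp.add_apply, PiLp.smul_apply, smul_eq_mul, inner_eq, cross_apply_zero,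
        cross_apply_one, cross_apply_two] <;> ring
  rw [ha, hb, hc, zero_smul, zero_smul, zero_smul, add_zero, add_zero] at key
  exact (smul_eq_zero.mp key).resolve_left h

/-- A point is determined by its distances from the corners of a skew quad. -/
theorem eq_of_dist_eq (hV : AffineIndependent ℝ V) {x y : E3}
    (h : ∀ i, dist x (V i) = dist y (V i)) : x = y := by
  have hi : ∀ i j, inner ℝ (x - y) (V i - V j) = 0 := by
    have e : ∀ i, ‖x - V i‖ ^ 2 = ‖y - V i‖ ^ 2 := fun i => by
      rw [← dist_eq_norm, ← dist_eq_norm, h]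
    intro i j
    have h1 := e i
    have h2 := e j
    simp only [← real_inner_self_eq_norm_sq, inner_eq, PiLp.sub_apply] at h1 h2 ⊢
    linear_combination (h2 - h1) / 2
  rw [affineIndependent_iff_tetVol] at hV
  exact sub_eq_zero.mp (eq_zero_of_inner_eq_zero hV (hi 1 0) (hi 2 0) (hi 3 0))

/-- The corner point that has fixed coordinates with respect to `A_i`, `B_i`, `A_i × B_i`. -/
def cornerPoint (V : Fin 4 → E3) (δ α β : Fin 4 → ℝ) (w : Fin 4 → Fin 3 → ℝ) (i : Fin 4) : E3 :=
  V i + ∑ j, w i j • ![sphA V i (δ i) (α i), sphB V i (δ i) (β i),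
    cross (sphA V i (δ i) (α i)) (sphB V i (δ i) (β i))] j

theorem exists_cornerPoint_eq (δ α β : Fin 4 → ℝ) (W : Fin 4 → E3)
    (h : ∀ i, inner ℝ (sphA V i (δ i) (α i)) (sphA V i (δ i) (α i)) *
      inner ℝ (sphB V i (δ i) (β i)) (sphB V i (δ i) (β i)) -
      inner ℝ (sphA V i (δ i) (α i)) (sphB V i (δ i) (β i)) ^ 2 ≠ (0 : ℝ)) :
    ∃ w, cornerPoint V δ α β w = W := by
  have key : ∀ i, ∃ w : Fin 3 → ℝ, V i + ∑ j, w j • ![sphA V i (δ i) (α i), sphB V i (δ i) (β i),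
    cross (sphA V i (δ i) (α i)) (sphB V i (δ i) (β i))] j = W i := by
    intro i
    have hb := cross_basis_expansion (sphA V i (δ i) (α i)) (sphB V i (δ i) (β i)) (W i - V i)
    have hi := h i
    set A := sphA V i (δ i) (α i)
    set B := sphB V i (δ i) (β i)
    set g := inner ℝ A A * inner ℝ B B - inner ℝ A B ^ 2
    refine ⟨![g⁻¹ * (inner ℝ (W i - V i) A * inner ℝ B B - inner ℝ (W i - V i) B * inner ℝ A B),
      g⁻¹ * (inner ℝ (W i - V i) B * inner ℝ A A - inner ℝ (W i - V i) A * inner ℝ A B),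
      g⁻¹ * inner ℝ (W i - V i) (cross A B)], ?_⟩
    rw [Fin.sum_univ_three]
    simp only [Matrix.cons_val, mul_smul]
    rw [← smul_add, ← smul_add, ← hb, smul_smul, inv_mul_cancel₀ hi, one_smul]
    abel
  choose w hw using key
  exact ⟨w, funext hw⟩

theorem gram_of_inner_three {A B C A' B' C' : E3} (hA : inner ℝ A A = inner ℝ A' A')
    (hB : inner ℝ B B = inner ℝ B' B') (hC : inner ℝ C C = inner ℝ C' C')
    (hAB : inner ℝ A B = inner ℝ A' B') (hAC : inner ℝ A C = inner ℝ A' C')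
    (hBC : inner ℝ B C = inner ℝ B' C') (j k : Fin 3) :
    inner ℝ (![A, B, C] j) (![A, B, C] k) = inner ℝ (![A', B', C'] j) (![A', B', C'] k) := by
  have hBA : inner ℝ B A = inner ℝ B' A' := by rw [real_inner_comm, hAB, real_inner_comm]
  have hCA : inner ℝ C A = inner ℝ C' A' := by rw [real_inner_comm, hAC, real_inner_comm]
  have hCB : inner ℝ C B = inner ℝ C' B' := by rw [real_inner_comm, hBC, real_inner_comm]
  fin_cases j <;> fin_cases k <;>
    simp only [Fin.zero_eta, Fin.mk_one, Fin.reduceFinMk, Matrix.cons_val] <;> assumption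

theorem gram_of_inner {A B A' B' : E3} (hA : inner ℝ A A = inner ℝ A' A')
    (hB : inner ℝ B B = inner ℝ B' B') (hAB : inner ℝ A B = inner ℝ A' B') (j k : Fin 3) :
    inner ℝ (![A, B, cross A B] j) (![A, B, cross A B] k) =
      inner ℝ (![A', B', cross A' B'] j) (![A', B', cross A' B'] k) := by
  have z1 : ∀ A B : E3, inner ℝ A (cross A B) = 0 := fun A B => by
    rw [real_inner_comm, inner_cross_left]
  have z2 : ∀ A B : E3, inner ℝ B (cross A B) = 0 := fun A B => by
    rw [real_inner_comm, inner_cross_right]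
  refine gram_of_inner_three hA hB ?_ hAB (by rw [z1, z1]) (by rw [z2, z2]) j k
  rw [inner_cross_cross, inner_cross_cross, real_inner_comm A B, real_inner_comm A' B', hA, hB, hAB]

theorem congruent_comp {ι κ : Type*} {p q : ι → E3} (h : Congruent p q) (σ : κ → ι) :
    Congruent (p ∘ σ) (q ∘ σ) := fun i j => h (σ i) (σ j)

/-- Two configurations with the same parameters have congruent faces. -/
theorem congruent_face_blockOf (hV : AffineIndependent ℝ V) {e f δ α β α' β' : Fin 4 → ℝ}
    (hδ : ∀ i, 0 < δ i ∧ δ i < π ∧ δ i ≠ lam V i ∧ IsCoefficient (lam V i) (δ i) (f i))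
    (hc : IsConfiguration e f α β) (hc' : IsConfiguration e f α' β') (s t : Fin 4 → ℝ)
    (w : Fin 4 → Fin 3 → ℝ) (i j : Fin 3) :
    Congruent (face (blockOf V δ α β s t (cornerPoint V δ α β w)) i j)
      (face (blockOf V δ α' β' s t (cornerPoint V δ α' β' w)) i j) := by
  have hAB : ∀ k, inner ℝ (sphA V k (δ k) (α k)) (sphB V k (δ k) (β k)) =
      inner ℝ (sphA V k (δ k) (α' k)) (sphB V k (δ k) (β' k)) := fun k => by
    rw [inner_sphA_sphB hV k (hδ k) (hc k).1, inner_sphA_sphB hV k (hδ k) (hc' k).1]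
  have hAB' : ∀ k, inner ℝ (sphA V (k + 1) (δ (k + 1)) (α (k + 1))) (sphB V k (δ k) (β k)) =
      inner ℝ (sphA V (k + 1) (δ (k + 1)) (α' (k + 1))) (sphB V k (δ k) (β' k)) := fun k => by
    have hang : ((α (k + 1) - β k : ℝ) : Real.Angle) = ((α' (k + 1) - β' k : ℝ) : Real.Angle) := by
      rw [Real.Angle.coe_sub, Real.Angle.coe_sub, (hc k).2, (hc' k).2, ← Real.Angle.coe_sub,
        ← Real.Angle.coe_sub]
      congr 1; ring
    rw [inner_sphA_succ_sphB hV, inner_sphA_succ_sphB hV,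
      ← Real.Angle.cos_coe (α (k + 1) - β k), ← Real.Angle.sin_coe (α (k + 1) - β k), hang,
        Real.Angle.cos_coe, Real.Angle.sin_coe]
  rcases face_block i j with ⟨σ, hσ⟩ | ⟨k, σ, hσ⟩ | ⟨k, σ, hσ⟩ <;>
    rw [blockOf, blockOf, hσ, hσ] <;> apply congruent_comp
  -- The corners of a side face have constant coordinates in the frame A_{k+1}, B_k, C_{k+1} at V_k,
  -- whose Gram matrix does not change.
  · have key : ∀ α β : Fin 4 → ℝ, ![V k, V (k + 1),
        V (k + 1) + s (k + 1) • sphA V (k + 1) (δ (k + 1)) (α (k + 1)),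
        V k + t k • sphB V k (δ k) (β k)] = fun i => V k + ∑ j,
          (![![0, 0, 0], ![0, 0, ‖edgeVec V (k + 1)‖], ![s (k + 1), 0, ‖edgeVec V (k + 1)‖],
            ![0, t k, 0]] : Fin 4 → Fin 3 → ℝ) i j •
          ![sphA V (k + 1) (δ (k + 1)) (α (k + 1)), sphB V k (δ k) (β k), sphC V (k + 1)] j := by
      intro α β
      have hv : V (k + 1) = V k + edgeVec V (k + 1) := by rw [← sub_edge]; abel
      funext i
      rw [Fin.sum_univ_three]
      fin_cases i <;>
        simp only [Fin.zero_eta, Fin.mk_one, Fin.reduceFinMk, Matrix.cons_val, zero_smul, zero_add,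
          add_zero, norm_smul_sphC hV]
      · exact hv
      · rw [hv]; abel
    rw [key, key]
    apply congruent_of_gram
    exact gram_of_inner_three (by rw [inner_sphA_self hV, inner_sphA_self hV])
      (by rw [inner_sphB_self hV, inner_sphB_self hV]) rfl (hAB' k)
      (by rw [inner_sphA_sphC hV, inner_sphA_sphC hV])
      (by rw [inner_sphB_sphC hV, inner_sphB_sphC hV])
  · have key : ∀ α β : Fin 4 → ℝ, ![V k, V k + t k • sphB V k (δ k) (β k),
        cornerPoint V δ α β w k, V k + s k • sphA V k (δ k) (α k)] = fun i => V k + ∑ j,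
          (![![0, 0, 0], ![0, t k, 0], w k, ![s k, 0, 0]] : Fin 4 → Fin 3 → ℝ) i j •
          ![sphA V k (δ k) (α k), sphB V k (δ k) (β k),
            cross (sphA V k (δ k) (α k)) (sphB V k (δ k) (β k))] j := by
      intro α β
      funext i
      fin_cases i
      · simp [Fin.sum_univ_three]
      · simp [Fin.sum_univ_three]
      · rfl
      · simp [Fin.sum_univ_three]
    rw [key, key]
    apply congruent_of_gram
    exact gram_of_inner (by rw [inner_sphA_self hV, inner_sphA_self hV])
      (by rw [inner_sphB_self hV, inner_sphB_self hV]) (hAB k)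

theorem continuous_block {X : Type*} [TopologicalSpace X] {P Q W : X → Fin 4 → E3}
    (hP : Continuous P) (hQ : Continuous Q) (hW : Continuous W) :
    Continuous fun x => block V (P x) (Q x) (W x) := by
  have hP := continuous_pi_iff.mp hP
  have hQ := continuous_pi_iff.mp hQ
  have hW := continuous_pi_iff.mp hW
  refine continuous_pi fun i => continuous_pi fun j => ?_
  fin_cases i <;> fin_cases j
  exacts [hW 0, hP 0, hQ 3, hW 3, hQ 0, continuous_const, continuous_const, hP 3, hP 1,
    continuous_const, continuous_const, hQ 2, hW 1, hQ 1, hP 2, hW 2]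

theorem continuous_blockOf {X : Type*} [TopologicalSpace X] (δ s t : Fin 4 → ℝ)
    {α β : X → Fin 4 → ℝ} (hα : Continuous α) (hβ : Continuous β) (w : Fin 4 → Fin 3 → ℝ) :
    Continuous fun x => blockOf V δ (α x) (β x) s t (cornerPoint V δ (α x) (β x) w) := by
  have hA : ∀ i, Continuous fun x => sphA V i (δ i) (α x i) := fun i =>
    (continuous_polarPoint _ _ _).comp ((continuous_apply i).comp hα)
  have hB : ∀ i, Continuous fun x => sphB V i (δ i) (β x i) := fun i =>
    (continuous_polarPoint _ _ _).comp ((continuous_apply i).comp hβ)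
  have hP : ∀ i, Continuous fun x => V i + s i • sphA V i (δ i) (α x i) := fun i =>
    continuous_const.add ((continuous_const (y := s i)).smul (hA i))
  have hQ : ∀ i, Continuous fun x => V i + t i • sphB V i (δ i) (β x i) := fun i =>
    continuous_const.add ((continuous_const (y := t i)).smul (hB i))
  have hW : ∀ i, Continuous fun x => cornerPoint V δ (α x) (β x) w i := by
    intro i
    refine continuous_const.add (continuous_finsetSum _ fun j _ => (continuous_const (y :=
      w i j)).smul ?_)
    fin_cases j
    exacts [hA i, hB i, Continuous.cross (hA i) (hB i)]
  exact continuous_block (continuous_pi hP) (continuous_pi hQ) (continuous_pi hW)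

/-- Both blocks share the skew quad V, so equal distances force equal points P₀, hence equal A₀ and
equal α₀ modulo 2π. -/
theorem not_congruent_blockOf (hV : AffineIndependent ℝ V) {δ α β α' β' s t : Fin 4 → ℝ}
    {W W' : Fin 4 → E3} (hδ : sin (δ 0) ≠ 0) (hs : s 0 ≠ 0) (h0 : (α 0 : Real.Angle) ≠ α' 0) :
    ¬ Congruent (fun v : Fin 4 × Fin 4 => blockOf V δ α β s t W v.1 v.2)
      (fun v : Fin 4 × Fin 4 => blockOf V δ α' β' s t' W' v.1 v.2) := by
  intro h
  apply h0
  have hd : ∀ i, dist (V 0 + s 0 • sphA V 0 (δ 0) (α 0)) (V i) =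
      dist (V 0 + s 0 • sphA V 0 (δ 0) (α' 0)) (V i) := by
    rw [congruent_iff_dist_eq] at h
    intro i
    fin_cases i
    exacts [h (0, 1) (1, 1), h (0, 1) (2, 1), h (0, 1) (2, 2), h (0, 1) (1, 2)]
  have h1 := smul_right_injective E3 hs (add_left_cancel (eq_of_dist_eq hV hd))
  exact polarPoint_injective (inner_sphC_self hV 0) (inner_nrm_self hV 0) (inner_nrm_sphC V 0) hδ h1

theorem continuouslyFlexible_blockOf (hV : AffineIndependent ℝ V) {e f δ α β s t : Fin 4 → ℝ}
    (hf : ∀ i, f i ≠ 0)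
    (hδ : ∀ i, 0 < δ i ∧ δ i < π ∧ δ i ≠ lam V i ∧ IsCoefficient (lam V i) (δ i) (f i))
    (he : ClosureEquations e f) (hc : IsConfiguration e f α β) (hst : ∀ i, s i * t i < 0)
    (W : Fin 4 → E3) : ContinuouslyFlexible (blockOf V δ α β s t W) := by
  obtain ⟨a, b, ha, hb, ha0, hab⟩ := exists_continuous_configuration hf he
  -- The Gram determinant of A_i, B_i is 1 - cos² λ_i = sin² λ_i. So any W_i has coordinates with
  -- respect to A_i, B_i, A_i × B_i, and the motion keeps them.
  obtain ⟨w, hw⟩ := exists_cornerPoint_eq (V := V) δ α β W fun i => by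
    rw [inner_sphA_self hV, inner_sphB_self hV, inner_sphA_sphB hV i (hδ i) (hc i).1, one_mul,
      ← sin_sq_add_cos_sq (lam V i), add_sub_cancel_right]
    exact pow_ne_zero 2 (sin_lam_pos hV i).ne'
  -- The continuous family meets the given angles only modulo 2π, which suffices for the points A_i,
  -- B_i.
  have hcongr := IsConfiguration.congr hf (hab (α 0)) hc (ha0 _)
  have hA : ∀ i, sphA V i (δ i) (a (α 0) i) = sphA V i (δ i) (α i) := fun i =>
    polarPoint_congr _ _ _ (hcongr i).1
  have hB : ∀ i, sphB V i (δ i) (b (α 0) i) = sphB V i (δ i) (β i) := fun i =>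
    polarPoint_congr _ _ _ (hcongr i).2
  have h0 : blockOf V δ (a (α 0)) (b (α 0)) s t (cornerPoint V δ (a (α 0)) (b (α 0)) w) =
      blockOf V δ α β s t W := by
    have : cornerPoint V δ (a (α 0)) (b (α 0)) w = W := by
      rw [← hw]; funext i; rw [cornerPoint, cornerPoint, hA, hB]
    rw [this]
    simp only [blockOf, hA, hB]
  refine ⟨fun x => blockOf V δ (a (α 0 + x)) (b (α 0 + x)) s t
    (cornerPoint V δ (a (α 0 + x)) (b (α 0 + x)) w), ?_, ?_, ?_, ?_⟩
  · exact (continuous_blockOf δ s t (ha.comp (continuous_const.add continuous_id))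
      (hb.comp (continuous_const.add continuous_id)) w).continuousOn
  · simp only [add_zero]
    exact h0
  · intro x _ i j
    rw [← h0]
    exact congruent_face_blockOf hV hδ (hab _) (hab _) s t w i j
  · intro x hx y hy hxy
    apply not_congruent_blockOf hV (sin_pos_of_pos_of_lt_pi (hδ 0).1 (hδ 0).2.1).ne'
    · intro h
      have := hst 0
      rw [h, zero_mul] at this
      exact lt_irrefl _ this
    -- The parameter interval has length 1 < 2π, so distinct parameters remain distinct modulo 2π.
    · rw [ha0, ha0, ne_eq, Real.Angle.angle_eq_iff_two_pi_dvd_sub]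
      rintro ⟨k, hk⟩
      have hpi := Real.pi_gt_three
      have hk0 : k ≠ 0 := by
        rintro rfl
        apply hxy
        have : (0 : ℝ) = ((0 : ℤ) : ℝ) := by norm_num
        rw [← this] at hk
        linarith
      have hk1 : (1 : ℝ) ≤ |(k : ℝ)| := by
        rw [← Int.cast_abs]; exact_mod_cast Int.one_le_abs hk0
      have h2 : |x - y| = 2 * π * |(k : ℝ)| := by
        rw [show x - y = 2 * π * k by linarith, abs_mul, abs_of_pos (by positivity : 0 < 2 * π)]
      have h3 : |x - y| ≤ 1 := abs_le.mpr ⟨by linarith [hx.1, hy.2], by linarith [hx.2, hy.1]⟩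
      nlinarith

end Flexibility

/-! ### Interval arithmetic for the example. -/

section Interval

open Set

/-- The separate bounds l, u allow decimal endpoints rounded outwards after every operation, which
keeps the rational arithmetic short. -/
theorem add_mem_Icc {x y a b c d l u : ℝ} (hx : x ∈ Icc a b) (hy : y ∈ Icc c d)
    (hl : l ≤ a + c) (hu : b + d ≤ u) : x + y ∈ Icc l u :=
  ⟨hl.trans (add_le_add hx.1 hy.1), (add_le_add hx.2 hy.2).trans hu⟩

theorem sub_mem_Icc {x y a b c d l u : ℝ} (hx : x ∈ Icc a b) (hy : y ∈ Icc c d)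
    (hl : l ≤ a - d) (hu : b - c ≤ u) : x - y ∈ Icc l u :=
  ⟨hl.trans (sub_le_sub hx.1 hy.2), (sub_le_sub hx.2 hy.1).trans hu⟩

theorem mul_mem_Icc {x y a b c d l u : ℝ} (hx : x ∈ Icc a b) (hy : y ∈ Icc c d) (ha : 0 ≤ a)
    (hc : 0 ≤ c) (hl : l ≤ a * c) (hu : b * d ≤ u) : x * y ∈ Icc l u :=
  ⟨hl.trans (mul_le_mul hx.1 hy.1 hc (ha.trans hx.1)),
    (mul_le_mul hx.2 hy.2 (hc.trans hy.1) ((ha.trans hx.1).trans hx.2)).trans hu⟩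

theorem div_mem_Icc {x y a b c d l u : ℝ} (hx : x ∈ Icc a b) (hy : y ∈ Icc c d) (ha : 0 ≤ a)
    (hc : 0 < c) (hl : l ≤ a / d) (hu : b / c ≤ u) : x / y ∈ Icc l u :=
  ⟨hl.trans (div_le_div₀ (ha.trans hx.1) hx.1 (hc.trans_le hy.1) hy.2),
    (div_le_div₀ ((ha.trans hx.1).trans hx.2) hx.2 hc hy.1).trans hu⟩

theorem sqrt_mem_Icc {x a b l u : ℝ} (hx : x ∈ Icc a b) (hu0 : 0 ≤ u)
    (hl : l ^ 2 ≤ a) (hu : b ≤ u ^ 2) : √x ∈ Icc l u :=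
  ⟨Real.le_sqrt_of_sq_le (hl.trans hx.1), Real.sqrt_le_iff.mpr ⟨hu0, hx.2.trans hu⟩⟩

theorem exf_zero_mem : (1 - 0.3 * ((√10 + 1) / 3)) / (1 + 0.3 * ((√10 + 1) / 3)) ∈
    Icc (0.412202223393083 : ℝ) 0.412202223393086 := by
  have ten : (10 : ℝ) ∈ Icc (10 : ℝ) 10 := ⟨le_rfl, le_rfl⟩
  have r : √10 ∈ Icc (3.162277660168379 : ℝ) 3.16227766016838 :=
    sqrt_mem_Icc ten (by norm_num) (by norm_num) (by norm_num)
  have one' : (1 : ℝ) ∈ Icc (1 : ℝ) 1 := ⟨le_rfl, le_rfl⟩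
  have n : √10 + 1 ∈ Icc (4.162277660168379 : ℝ) 4.16227766016838 :=
    add_mem_Icc r one' (by norm_num) (by norm_num)
  have three : (3 : ℝ) ∈ Icc (3 : ℝ) 3 := ⟨le_rfl, le_rfl⟩
  have t : (√10 + 1) / 3 ∈ Icc (1.387425886722793 : ℝ) 1.387425886722794 :=
    div_mem_Icc n three (by norm_num) (by norm_num) (by norm_num) (by norm_num)
  have one : (1 : ℝ) ∈ Icc (1 : ℝ) 1 := ⟨le_rfl, le_rfl⟩
  have hd : (0.3 : ℝ) ∈ Icc (0.3 : ℝ) 0.3 := ⟨le_rfl, le_rfl⟩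
  have hdt : 0.3 * ((√10 + 1) / 3) ∈ Icc (0.416227766016837 : ℝ) 0.416227766016839 :=
    mul_mem_Icc hd t (by norm_num) (by norm_num) (by norm_num) (by norm_num)
  have hn : 1 - (0.3 * ((√10 + 1) / 3)) ∈ Icc (0.583772233983161 : ℝ) 0.583772233983163 :=
    sub_mem_Icc one hdt (by norm_num) (by norm_num)
  have hp : 1 + (0.3 * ((√10 + 1) / 3)) ∈ Icc (1.416227766016837 : ℝ) 1.416227766016839 :=
    add_mem_Icc one hdt (by norm_num) (by norm_num)
  have hf : (1 - (0.3 * ((√10 + 1) / 3))) / (1 + (0.3 * ((√10 + 1) / 3))) ∈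
      Icc (0.412202223393083 : ℝ) 0.412202223393086 :=
    div_mem_Icc hn hp (by norm_num) (by norm_num) (by norm_num) (by norm_num)
  exact hf

theorem exf_two_mem : (1 - 0.2 * (((3 * √14) - 1) / (5 * √5))) / (1 + 0.2 * (((3 * √14) - 1)
    / (5 * √5))) ∈
    Icc (0.690745899853835 : ℝ) 0.690745899853838 := by
  have fourteen : (14 : ℝ) ∈ Icc (14 : ℝ) 14 := ⟨le_rfl, le_rfl⟩
  have r : √14 ∈ Icc (3.741657386773941 : ℝ) 3.741657386773942 :=
    sqrt_mem_Icc fourteen (by norm_num) (by norm_num) (by norm_num)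
  have one' : (1 : ℝ) ∈ Icc (1 : ℝ) 1 := ⟨le_rfl, le_rfl⟩
  have three : (3 : ℝ) ∈ Icc (3 : ℝ) 3 := ⟨le_rfl, le_rfl⟩
  have m : 3 * √14 ∈ Icc (11.224972160321823 : ℝ) 11.224972160321826 :=
    mul_mem_Icc three r (by norm_num) (by norm_num) (by norm_num) (by norm_num)
  have n : (3 * √14) - 1 ∈ Icc (10.224972160321823 : ℝ) 10.224972160321826 :=
    sub_mem_Icc m one' (by norm_num) (by norm_num)
  have five : (5 : ℝ) ∈ Icc (5 : ℝ) 5 := ⟨le_rfl, le_rfl⟩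
  have r' : √5 ∈ Icc (2.236067977499789 : ℝ) 2.23606797749979 :=
    sqrt_mem_Icc five (by norm_num) (by norm_num) (by norm_num)
  have m' : 5 * √5 ∈ Icc (11.180339887498945 : ℝ) 11.18033988749895 :=
    mul_mem_Icc five r' (by norm_num) (by norm_num) (by norm_num) (by norm_num)
  have t : ((3 * √14) - 1) / (5 * √5) ∈ Icc (0.914549312740898 : ℝ) 0.9145493127409 :=
    div_mem_Icc n m' (by norm_num) (by norm_num) (by norm_num) (by norm_num)
  have one : (1 : ℝ) ∈ Icc (1 : ℝ) 1 := ⟨le_rfl, le_rfl⟩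
  have hd : (0.2 : ℝ) ∈ Icc (0.2 : ℝ) 0.2 := ⟨le_rfl, le_rfl⟩
  have hdt : 0.2 * (((3 * √14) - 1) / (5 * √5)) ∈ Icc (0.182909862548179 : ℝ) 0.18290986254818 :=
    mul_mem_Icc hd t (by norm_num) (by norm_num) (by norm_num) (by norm_num)
  have hn : 1 - (0.2 * (((3 * √14) - 1) / (5 * √5))) ∈
      Icc (0.81709013745182 : ℝ) 0.817090137451821 :=
    sub_mem_Icc one hdt (by norm_num) (by norm_num)
  have hp : 1 + (0.2 * (((3 * √14) - 1) / (5 * √5))) ∈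
      Icc (1.182909862548179 : ℝ) 1.18290986254818 :=
    add_mem_Icc one hdt (by norm_num) (by norm_num)
  have hf : (1 - (0.2 * (((3 * √14) - 1) / (5 * √5)))) / (1 + (0.2 * (((3 * √14) - 1)
      / (5 * √5)))) ∈ Icc (0.690745899853835 : ℝ) 0.690745899853838 :=
    div_mem_Icc hn hp (by norm_num) (by norm_num) (by norm_num) (by norm_num)
  exact hf

theorem exf_three_mem : (1 - 0.25 * √2) / (1 + 0.25 * √2) ∈
    Icc (0.477592250072516 : ℝ) 0.477592250072518 := by
  have two : (2 : ℝ) ∈ Icc (2 : ℝ) 2 := ⟨le_rfl, le_rfl⟩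
  have t : √2 ∈ Icc (1.414213562373095 : ℝ) 1.414213562373096 :=
    sqrt_mem_Icc two (by norm_num) (by norm_num) (by norm_num)
  have one : (1 : ℝ) ∈ Icc (1 : ℝ) 1 := ⟨le_rfl, le_rfl⟩
  have hd : (0.25 : ℝ) ∈ Icc (0.25 : ℝ) 0.25 := ⟨le_rfl, le_rfl⟩
  have hdt : 0.25 * √2 ∈ Icc (0.353553390593273 : ℝ) 0.353553390593274 :=
    mul_mem_Icc hd t (by norm_num) (by norm_num) (by norm_num) (by norm_num)
  have hn : 1 - (0.25 * √2) ∈ Icc (0.646446609406726 : ℝ) 0.646446609406727 :=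
    sub_mem_Icc one hdt (by norm_num) (by norm_num)
  have hp : 1 + (0.25 * √2) ∈ Icc (1.353553390593273 : ℝ) 1.353553390593274 :=
    add_mem_Icc one hdt (by norm_num) (by norm_num)
  have hf : (1 - (0.25 * √2)) / (1 + (0.25 * √2)) ∈ Icc (0.477592250072516 : ℝ) 0.477592250072518 :=
    div_mem_Icc hn hp (by norm_num) (by norm_num) (by norm_num) (by norm_num)
  exact hf

/-- For e₀ = 100 these are rad₁, rad₂, -den₁, den₃ and the root-free numerator parts. The signs are
arranged so that every factor is positive, as `mul_mem_Icc` requires non-negative ranges. -/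
theorem example_bounds {a b c d : ℝ}
    (ha : a ∈ Icc (0.412202223393083 : ℝ) 0.412202223393086)
    (hb : b ∈ Icc (0.739130434782608 : ℝ) 0.739130434782609)
    (hc : c ∈ Icc (0.690745899853835 : ℝ) 0.690745899853838)
    (hd : d ∈ Icc (0.477592250072516 : ℝ) 0.477592250072518) :
    (10000 * (((c * d) - (a * b)) * ((b * d) - (a * c)))) + ((c - ((a * b) * d)) * (b
      - ((a * c) * d))) ∈
      Icc (17.550570839380354 : ℝ) 17.550570839400362 ∧
    (10000 * ((d - ((a * b) * c)) * (a - ((b * c) * d)))) - ((1 - ((a * b) * (c * d)))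
      * ((b * c) - (a * d))) ∈
      Icc (449.496235809313444 : ℝ) 449.496235809353453 ∧
    (10000 * (((b * d) - (a * c)) * (a - ((b * c) * d)))) - (((b * c) - (a * d)) * (b
      - ((a * c) * d))) ∈
      Icc (114.764918016185372 : ℝ) 114.764918016215378 ∧
    (10000 * (((b * d) - (a * c)) * (d - ((a * b) * c)))) + (((b * c) - (a * d)) * (c
      - ((a * b) * d))) ∈
      Icc (182.564735822802303 : ℝ) 182.56473582283231 ∧
    100 * (((a * c) * (1 - (b * b))) * (1 - (d * d))) ∈
      Icc (9.9712230449818 : ℝ) 9.9712230449822 ∧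
    100 * (((b * d) * (1 - (a * a))) * (1 - (c * c))) ∈
      Icc (15.3213486464396 : ℝ) 15.3213486464401 := by
  have one : (1 : ℝ) ∈ Icc (1 : ℝ) 1 := ⟨le_rfl, le_rfl⟩
  have hx : (10000 : ℝ) ∈ Icc (10000 : ℝ) 10000 := ⟨le_rfl, le_rfl⟩
  have hy : (100 : ℝ) ∈ Icc (100 : ℝ) 100 := ⟨le_rfl, le_rfl⟩
  have hab : a * b ∈ Icc (0.304671208594887 : ℝ) 0.30467120859489 :=
    mul_mem_Icc ha hb (by norm_num) (by norm_num) (by norm_num) (by norm_num)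
  have hcd : c * d ∈ Icc (0.329894888539557 : ℝ) 0.329894888539561 :=
    mul_mem_Icc hc hd (by norm_num) (by norm_num) (by norm_num) (by norm_num)
  have hac : a * c ∈ Icc (0.284726995719406 : ℝ) 0.28472699571941 :=
    mul_mem_Icc ha hc (by norm_num) (by norm_num) (by norm_num) (by norm_num)
  have hbd : b * d ∈ Icc (0.353002967444902 : ℝ) 0.353002967444905 :=
    mul_mem_Icc hb hd (by norm_num) (by norm_num) (by norm_num) (by norm_num)
  have had : a * d ∈ Icc (0.196864587355196 : ℝ) 0.196864587355199 :=
    mul_mem_Icc ha hd (by norm_num) (by norm_num) (by norm_num) (by norm_num)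
  have hbc : b * c ∈ Icc (0.510551317283268 : ℝ) 0.510551317283272 :=
    mul_mem_Icc hb hc (by norm_num) (by norm_num) (by norm_num) (by norm_num)
  have habd : (a * b) * d ∈ Icc (0.145508608045144 : ℝ) 0.145508608045148 :=
    mul_mem_Icc hab hd (by norm_num) (by norm_num) (by norm_num) (by norm_num)
  have hacd : (a * c) * d ∈ Icc (0.135983406542018 : ℝ) 0.135983406542022 :=
    mul_mem_Icc hac hd (by norm_num) (by norm_num) (by norm_num) (by norm_num)
  have habc : (a * b) * c ∈ Icc (0.21045038814043 : ℝ) 0.210450388140434 :=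
    mul_mem_Icc hab hc (by norm_num) (by norm_num) (by norm_num) (by norm_num)
  have hbcd : (b * c) * d ∈ Icc (0.243835352398802 : ℝ) 0.243835352398806 :=
    mul_mem_Icc hbc hd (by norm_num) (by norm_num) (by norm_num) (by norm_num)
  have habcd : (a * b) * (c * d) ∈ Icc (0.100509474400622 : ℝ) 0.100509474400625 :=
    mul_mem_Icc hab hcd (by norm_num) (by norm_num) (by norm_num) (by norm_num)
  have k1 : (c * d) - (a * b) ∈ Icc (0.025223679944667 : ℝ) 0.025223679944674 :=
    sub_mem_Icc hcd hab (by norm_num) (by norm_num)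
  have k2 : (b * d) - (a * c) ∈ Icc (0.068275971725492 : ℝ) 0.068275971725499 :=
    sub_mem_Icc hbd hac (by norm_num) (by norm_num)
  have k3 : (b * c) - (a * d) ∈ Icc (0.313686729928069 : ℝ) 0.313686729928076 :=
    sub_mem_Icc hbc had (by norm_num) (by norm_num)
  have k4 : c - ((a * b) * d) ∈ Icc (0.545237291808687 : ℝ) 0.545237291808694 :=
    sub_mem_Icc hc habd (by norm_num) (by norm_num)
  have k5 : b - ((a * c) * d) ∈ Icc (0.603147028240586 : ℝ) 0.603147028240591 :=
    sub_mem_Icc hb hacd (by norm_num) (by norm_num)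
  have k6 : a - ((b * c) * d) ∈ Icc (0.168366870994277 : ℝ) 0.168366870994284 :=
    sub_mem_Icc ha hbcd (by norm_num) (by norm_num)
  have k7 : d - ((a * b) * c) ∈ Icc (0.267141861932082 : ℝ) 0.267141861932088 :=
    sub_mem_Icc hd habc (by norm_num) (by norm_num)
  have k8 : 1 - ((a * b) * (c * d)) ∈ Icc (0.899490525599375 : ℝ) 0.899490525599378 :=
    sub_mem_Icc one habcd (by norm_num) (by norm_num)
  have sa : a * a ∈ Icc (0.169910672970201 : ℝ) 0.169910672970204 :=
    mul_mem_Icc ha ha (by norm_num) (by norm_num) (by norm_num) (by norm_num)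
  have ua : 1 - (a * a) ∈ Icc (0.830089327029796 : ℝ) 0.830089327029799 :=
    sub_mem_Icc one sa (by norm_num) (by norm_num)
  have sb : b * b ∈ Icc (0.546313799621927 : ℝ) 0.546313799621929 :=
    mul_mem_Icc hb hb (by norm_num) (by norm_num) (by norm_num) (by norm_num)
  have ub : 1 - (b * b) ∈ Icc (0.453686200378071 : ℝ) 0.453686200378073 :=
    sub_mem_Icc one sb (by norm_num) (by norm_num)
  have sc : c * c ∈ Icc (0.477129898164884 : ℝ) 0.477129898164889 :=
    mul_mem_Icc hc hc (by norm_num) (by norm_num) (by norm_num) (by norm_num)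
  have uc : 1 - (c * c) ∈ Icc (0.522870101835111 : ℝ) 0.522870101835116 :=
    sub_mem_Icc one sc (by norm_num) (by norm_num)
  have sd : d * d ∈ Icc (0.228094357329328 : ℝ) 0.228094357329331 :=
    mul_mem_Icc hd hd (by norm_num) (by norm_num) (by norm_num) (by norm_num)
  have ud : 1 - (d * d) ∈ Icc (0.771905642670669 : ℝ) 0.771905642670672 :=
    sub_mem_Icc one sd (by norm_num) (by norm_num)
  have hr₁p : ((c * d) - (a * b)) * ((b * d) - (a * c)) ∈
      Icc (0.001722171258714 : ℝ) 0.001722171258716 :=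
    mul_mem_Icc k1 k2 (by norm_num) (by norm_num) (by norm_num) (by norm_num)
  have hr₁x : 10000 * (((c * d) - (a * b)) * ((b * d) - (a * c))) ∈
      Icc (17.22171258714 : ℝ) 17.22171258716 :=
    mul_mem_Icc hx hr₁p (by norm_num) (by norm_num) (by norm_num) (by norm_num)
  have hr₁q : (c - ((a * b) * d)) * (b - ((a * c) * d)) ∈
      Icc (0.328858252240354 : ℝ) 0.328858252240362 :=
    mul_mem_Icc k4 k5 (by norm_num) (by norm_num) (by norm_num) (by norm_num)
  have hr₁ : (10000 * (((c * d) - (a * b)) * ((b * d) - (a * c)))) + ((c - ((a * b) * d)) * (b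
      - ((a * c) * d))) ∈ Icc (17.550570839380354 : ℝ) 17.550570839400362 :=
    add_mem_Icc hr₁x hr₁q (by norm_num) (by norm_num)
  have hr₂p : (d - ((a * b) * c)) * (a - ((b * c) * d)) ∈
      Icc (0.044977839405089 : ℝ) 0.044977839405093 :=
    mul_mem_Icc k7 k6 (by norm_num) (by norm_num) (by norm_num) (by norm_num)
  have hr₂x : 10000 * ((d - ((a * b) * c)) * (a - ((b * c) * d))) ∈
      Icc (449.77839405089 : ℝ) 449.77839405093 :=
    mul_mem_Icc hx hr₂p (by norm_num) (by norm_num) (by norm_num) (by norm_num)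
  have hr₂q : (1 - ((a * b) * (c * d))) * ((b * c) - (a * d)) ∈
      Icc (0.282158241576547 : ℝ) 0.282158241576556 :=
    mul_mem_Icc k8 k3 (by norm_num) (by norm_num) (by norm_num) (by norm_num)
  have hr₂ : (10000 * ((d - ((a * b) * c)) * (a - ((b * c) * d)))) - ((1 - ((a * b)
      * (c * d))) * ((b * c) - (a * d))) ∈ Icc (449.496235809313444 : ℝ) 449.496235809353453 :=
    sub_mem_Icc hr₂x hr₂q (by norm_num) (by norm_num)
  have hd₁p : ((b * d) - (a * c)) * (a - ((b * c) * d)) ∈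
      Icc (0.011495411723514 : ℝ) 0.011495411723517 :=
    mul_mem_Icc k2 k6 (by norm_num) (by norm_num) (by norm_num) (by norm_num)
  have hd₁x : 10000 * (((b * d) - (a * c)) * (a - ((b * c) * d))) ∈
      Icc (114.95411723514 : ℝ) 114.95411723517 :=
    mul_mem_Icc hx hd₁p (by norm_num) (by norm_num) (by norm_num) (by norm_num)
  have hd₁q : ((b * c) - (a * d)) * (b - ((a * c) * d)) ∈
      Icc (0.189199218954622 : ℝ) 0.189199218954628 :=
    mul_mem_Icc k3 k5 (by norm_num) (by norm_num) (by norm_num) (by norm_num)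
  have hd₁ : (10000 * (((b * d) - (a * c)) * (a - ((b * c) * d)))) - (((b * c) - (a * d)) * (b
      - ((a * c) * d))) ∈ Icc (114.764918016185372 : ℝ) 114.764918016215378 :=
    sub_mem_Icc hd₁x hd₁q (by norm_num) (by norm_num)
  have hd₃p : ((b * d) - (a * c)) * (d - ((a * b) * c)) ∈
      Icc (0.01823937021197 : ℝ) 0.018239370211973 :=
    mul_mem_Icc k2 k7 (by norm_num) (by norm_num) (by norm_num) (by norm_num)
  have hd₃x : 10000 * (((b * d) - (a * c)) * (d - ((a * b) * c))) ∈
      Icc (182.3937021197 : ℝ) 182.39370211973 :=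
    mul_mem_Icc hx hd₃p (by norm_num) (by norm_num) (by norm_num) (by norm_num)
  have hd₃q : ((b * c) - (a * d)) * (c - ((a * b) * d)) ∈
      Icc (0.171033703102303 : ℝ) 0.17103370310231 :=
    mul_mem_Icc k3 k4 (by norm_num) (by norm_num) (by norm_num) (by norm_num)
  have hd₃ : (10000 * (((b * d) - (a * c)) * (d - ((a * b) * c)))) + (((b * c) - (a * d)) * (c
      - ((a * b) * d))) ∈ Icc (182.564735822802303 : ℝ) 182.56473582283231 :=
    add_mem_Icc hd₃x hd₃q (by norm_num) (by norm_num)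
  have m1 : (a * c) * (1 - (b * b)) ∈ Icc (0.129176708833 : ℝ) 0.129176708833003 :=
    mul_mem_Icc hac ub (by norm_num) (by norm_num) (by norm_num) (by norm_num)
  have m2 : ((a * c) * (1 - (b * b))) * (1 - (d * d)) ∈
      Icc (0.099712230449818 : ℝ) 0.099712230449822 :=
    mul_mem_Icc m1 ud (by norm_num) (by norm_num) (by norm_num) (by norm_num)
  have hn₁ : 100 * (((a * c) * (1 - (b * b))) * (1 - (d * d))) ∈
      Icc (9.9712230449818 : ℝ) 9.9712230449822 :=
    mul_mem_Icc hy m2 (by norm_num) (by norm_num) (by norm_num) (by norm_num)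
  have m3 : (b * d) * (1 - (a * a)) ∈ Icc (0.293023995685859 : ℝ) 0.293023995685864 :=
    mul_mem_Icc hbd ua (by norm_num) (by norm_num) (by norm_num) (by norm_num)
  have m4 : ((b * d) * (1 - (a * a))) * (1 - (c * c)) ∈
      Icc (0.153213486464396 : ℝ) 0.153213486464401 :=
    mul_mem_Icc m3 uc (by norm_num) (by norm_num) (by norm_num) (by norm_num)
  have hn₃ : 100 * (((b * d) * (1 - (a * a))) * (1 - (c * c))) ∈
      Icc (15.3213486464396 : ℝ) 15.3213486464401 :=
    mul_mem_Icc hy m4 (by norm_num) (by norm_num) (by norm_num) (by norm_num)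
  exact ⟨hr₁, hr₂, hd₁, hd₃, hn₁, hn₃⟩

theorem example_solution_bounds {r₁ r₂ d₁ d₃ n₁ n₃ : ℝ}
    (hr₁ : r₁ ∈ Icc (17.550570839380354 : ℝ) 17.550570839400362)
    (hr₂ : r₂ ∈ Icc (449.496235809313444 : ℝ) 449.496235809353453)
    (hd₁ : d₁ ∈ Icc (114.764918016185372 : ℝ) 114.764918016215378)
    (hd₃ : d₃ ∈ Icc (182.564735822802303 : ℝ) 182.56473582283231)
    (hn₁ : n₁ ∈ Icc (9.9712230449818 : ℝ) 9.9712230449822)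
    (hn₃ : n₃ ∈ Icc (15.3213486464396 : ℝ) 15.3213486464401) :
    |(n₁ + √r₁ * √r₂) / d₁ - 0.86081001| < 5e-9 ∧ |√r₁ * √r₂ / r₁ - 5.06077939| < 5e-9 ∧
      |(n₃ + √r₁ * √r₂) / d₃ - 0.57043281| < 5e-9 := by
  have q₁ : √r₁ ∈ Icc (4.189340143671835 : ℝ) 4.189340143674224 :=
    sqrt_mem_Icc hr₁ (by norm_num) (by norm_num) (by norm_num)
  have q₂ : √r₂ ∈ Icc (21.201326274771431 : ℝ) 21.201326274772375 :=
    sqrt_mem_Icc hr₂ (by norm_num) (by norm_num) (by norm_num)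
  have hS : √r₁ * √r₂ ∈ Icc (88.819567261984397 : ℝ) 88.819567262039002 :=
    mul_mem_Icc q₁ q₂ (by norm_num) (by norm_num) (by norm_num) (by norm_num)
  have t₁ : n₁ + (√r₁ * √r₂) ∈ Icc (98.790790306966197 : ℝ) 98.790790307021202 :=
    add_mem_Icc hn₁ hS (by norm_num) (by norm_num)
  have e₁ : (n₁ + (√r₁ * √r₂)) / d₁ ∈ Icc (0.860810010712575 : ℝ) 0.86081001071328 :=
    div_mem_Icc t₁ hd₁ (by norm_num) (by norm_num) (by norm_num) (by norm_num)
  have e₂ : (√r₁ * √r₂) / r₁ ∈ Icc (5.060779394285447 : ℝ) 5.060779394294328 :=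
    div_mem_Icc hS hr₁ (by norm_num) (by norm_num) (by norm_num) (by norm_num)
  have t₃ : n₃ + (√r₁ * √r₂) ∈ Icc (104.140915908423997 : ℝ) 104.140915908479102 :=
    add_mem_Icc hn₃ hS (by norm_num) (by norm_num)
  have e₃ : (n₃ + (√r₁ * √r₂)) / d₃ ∈ Icc (0.570432813539008 : ℝ) 0.570432813539404 :=
    div_mem_Icc t₃ hd₃ (by norm_num) (by norm_num) (by norm_num) (by norm_num)
  refine ⟨abs_sub_lt_iff.mpr ⟨?_, ?_⟩, abs_sub_lt_iff.mpr ⟨?_, ?_⟩, abs_sub_lt_iff.mpr ⟨?_, ?_⟩⟩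
  · linarith [e₁.2]
  · linarith [e₁.1]
  · linarith [e₂.2]
  · linarith [e₂.1]
  · linarith [e₃.2]
  · linarith [e₃.1]

end Interval

/-! ### The central quad of the example and its angles. -/

section Example

open Real

theorem cos_two_arctan (t : ℝ) : cos (2 * arctan t) = (1 - t ^ 2) / (1 + t ^ 2) := by
  have : 1 + t ^ 2 ≠ 0 := by positivity
  rw [cos_two_mul, cos_sq_arctan]
  field_simp
  ring

theorem sin_two_arctan (t : ℝ) : sin (2 * arctan t) = 2 * t / (1 + t ^ 2) := by
  have h : sin (arctan t) = t * cos (arctan t) := by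
    have := tan_mul_cos (cos_arctan_pos t).ne'
    rwa [tan_arctan, eq_comm] at this
  have : 1 + t ^ 2 ≠ 0 := by positivity
  have hc := cos_sq_arctan t
  rw [sin_two_mul, h]
  field_simp at hc ⊢
  linear_combination t * hc

/-- In half-angle tangents numerator and denominator share the factor d - t, which cancels. -/
theorem coefficient_two_arctan {d t : ℝ} (hd : 0 < d) (ht : 0 < t) (h : d ≠ t) :
    (sin (2 * arctan d) - sin (2 * arctan t)) / sin (2 * arctan d - 2 * arctan t) =
      (1 - d * t) / (1 + d * t) := by
  have h1 : 1 + d ^ 2 ≠ 0 := by positivity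
  have h2 : 1 + t ^ 2 ≠ 0 := by positivity
  have h3 : 1 + d * t ≠ 0 := by positivity
  have h4 : d - t ≠ 0 := sub_ne_zero.mpr h
  have e1 : sin (2 * arctan d - 2 * arctan t) =
      2 * (d - t) * (1 + d * t) / ((1 + d ^ 2) * (1 + t ^ 2)) := by
    rw [sin_sub, sin_two_arctan, sin_two_arctan, cos_two_arctan, cos_two_arctan]
    field_simp
    ring
  have e2 : sin (2 * arctan d) - sin (2 * arctan t) =
      2 * (d - t) * (1 - d * t) / ((1 + d ^ 2) * (1 + t ^ 2)) := by
    rw [sin_two_arctan, sin_two_arctan]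
    field_simp
    ring
  rw [e1, e2]
  field_simp

theorem two_arctan_mem {t : ℝ} (ht : 0 < t) : 0 < 2 * arctan t ∧ 2 * arctan t < π := by
  have h1 := arctan_pos.mpr ht
  have h2 := arctan_lt_pi_div_two t
  constructor <;> linarith

theorem angle_eq_two_arctan {u v : E3} {t : ℝ} (ht : 0 < t)
    (h : inner ℝ u v * (1 + t ^ 2) = (1 - t ^ 2) * (‖u‖ * ‖v‖)) (hu : u ≠ 0) (hv : v ≠ 0) :
    InnerProductGeometry.angle u v = 2 * arctan t := by
  have h1 := two_arctan_mem ht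
  have hu' := norm_ne_zero_iff.mpr hu
  have hv' := norm_ne_zero_iff.mpr hv
  have h2 : 1 + t ^ 2 ≠ 0 := by positivity
  apply injOn_cos ⟨InnerProductGeometry.angle_nonneg _ _, InnerProductGeometry.angle_le_pi _ _⟩
    ⟨h1.1.le, h1.2.le⟩
  rw [cos_two_arctan, InnerProductGeometry.cos_angle]
  field_simp
  linear_combination h

theorem norm_eq_sqrt_sum (v : E3) : ‖v‖ = √(v 0 ^ 2 + v 1 ^ 2 + v 2 ^ 2) := by
  rw [norm_eq_sqrt_real_inner, inner_eq]
  congr 1; ring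

theorem exV_edge_zero : edgeVec exV 0 = !₂[5, 0, 0] := by
  change (!₂[5, 0, 0] : E3) - !₂[0, 0, 0] = _
  apply e3_ext <;> simp

theorem exV_edge_one : edgeVec exV 1 = !₂[-1, 3, 0] := by
  change (!₂[4, 3, 0] : E3) - !₂[5, 0, 0] = _
  apply e3_ext <;> simp <;> norm_num

theorem exV_edge_two : edgeVec exV 2 = !₂[-3, -1, 2] := by
  change (!₂[1, 2, 2] : E3) - !₂[4, 3, 0] = _
  apply e3_ext <;> simp <;> norm_num

theorem exV_edge_three : edgeVec exV 3 = !₂[-1, -2, -2] := by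
  change (!₂[0, 0, 0] : E3) - !₂[1, 2, 2] = _
  apply e3_ext <;> simp

theorem exV_affineIndependent : AffineIndependent ℝ exV := by
  rw [affineIndependent_iff_tetVol]
  simp only [tetVol, inner_eq, cross_apply_zero, cross_apply_one, cross_apply_two,
    PiLp.sub_apply, exV, Matrix.cons_val]
  norm_num

theorem norm_exV_edge_zero : ‖edgeVec exV 0‖ = 5 := by
  rw [norm_eq_sqrt_sum, exV_edge_zero]
  simp

theorem norm_exV_edge_one : ‖edgeVec exV 1‖ = √10 := by
  rw [norm_eq_sqrt_sum, exV_edge_one]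
  simp; norm_num

theorem norm_exV_edge_two : ‖edgeVec exV 2‖ = √14 := by
  rw [norm_eq_sqrt_sum, exV_edge_two]
  simp; norm_num

theorem norm_exV_edge_three : ‖edgeVec exV 3‖ = 3 := by
  rw [norm_eq_sqrt_sum, exV_edge_three]
  simp; rw [sqrt_eq_iff_mul_self_eq] <;> norm_num

/-- The half-angle tangents of the angles of the central quad of the example. -/
def exTan : Fin 4 → ℝ := ![(√10 + 1) / 3, 1, (3 * √14 - 1) / (5 * √5), √2]

theorem three_lt_sqrt_fourteen : 3 < √14 := lt_sqrt_of_sq_lt (by norm_num)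

theorem exTan_bounds (i : Fin 4) : 0 < exTan i ∧ ![0.3, 0.15, 0.2, 0.25] i ≠ exTan i := by
  have h10 : 3 < √10 := lt_sqrt_of_sq_lt (by norm_num)
  have h14 := three_lt_sqrt_fourteen
  have h5 : √5 < 3 := (sqrt_lt' (by norm_num)).mpr (by norm_num)
  have h5' : 0 < √5 := by positivity
  have h2 : 1 < √2 := lt_sqrt_of_sq_lt (by norm_num)
  -- No d_i exceeds 0.3, so this separates every d_i from tan(λ_i/2).
  have key : (0.3 : ℝ) < exTan i := by
    fin_cases i
    · simp only [exTan, Fin.zero_eta, Matrix.cons_val]; linarith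
    · simp only [exTan, Fin.mk_one, Matrix.cons_val]; norm_num
    · simp only [exTan, Fin.reduceFinMk, Matrix.cons_val]
      rw [lt_div_iff₀ (by positivity)]; linarith
    · simp only [exTan, Fin.reduceFinMk, Matrix.cons_val]; linarith
  refine ⟨by linarith, ?_⟩
  have : (![0.3, 0.15, 0.2, 0.25] i : ℝ) ≤ 0.3 := by
    fin_cases i <;> simp <;> norm_num
  linarith

/-- The edges give cos λ_i = -1/√10, 0, 1/(3√14), -1/3, and tan²(λ/2) = (1 - cos λ)/(1 + cos λ). -/
theorem lam_exV (i : Fin 4) : lam exV i = 2 * arctan (exTan i) := by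
  have h10 : √10 ^ 2 = 10 := sq_sqrt (by norm_num)
  have h14 : √14 ^ 2 = 14 := sq_sqrt (by norm_num)
  have h5 : √5 ^ 2 = 5 := sq_sqrt (by norm_num)
  have h2 : √2 ^ 2 = 2 := sq_sqrt (by norm_num)
  refine angle_eq_two_arctan (exTan_bounds i).1 ?_ (edgeVec_ne_zero exV_affineIndependent i)
    (edgeVec_ne_zero exV_affineIndependent (i + 1))
  fin_cases i
  · change inner ℝ (edgeVec exV 0) (edgeVec exV 1) * (1 + ((√10 + 1) / 3) ^ 2) =
      (1 - ((√10 + 1) / 3) ^ 2) * (‖edgeVec exV 0‖ * ‖edgeVec exV 1‖)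
    rw [norm_exV_edge_zero, norm_exV_edge_one, inner_eq, exV_edge_zero, exV_edge_one]
    simp
    linear_combination (-5 / 9 + 5 / 9 * √10 + 10 / 9) * h10
  · change inner ℝ (edgeVec exV 1) (edgeVec exV 2) * (1 + (1 : ℝ) ^ 2) =
      (1 - (1 : ℝ) ^ 2) * (‖edgeVec exV 1‖ * ‖edgeVec exV 2‖)
    rw [inner_eq, exV_edge_one, exV_edge_two]
    simp
  · change inner ℝ (edgeVec exV 2) (edgeVec exV 3) * (1 + ((3 * √14 - 1) / (5 * √5)) ^ 2) =
      (1 - ((3 * √14 - 1) / (5 * √5)) ^ 2) * (‖edgeVec exV 2‖ * ‖edgeVec exV 3‖)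
    rw [norm_exV_edge_two, norm_exV_edge_three, inner_eq, exV_edge_two, exV_edge_three, div_pow,
      mul_pow, h5]
    simp
    linear_combination (27 / 125 * √14 + 9 / 125 - 18 / 125) * h14
  · change inner ℝ (edgeVec exV 3) (edgeVec exV 0) * (1 + √2 ^ 2) =
      (1 - √2 ^ 2) * (‖edgeVec exV 3‖ * ‖edgeVec exV 0‖)
    rw [norm_exV_edge_three, norm_exV_edge_zero, inner_eq, exV_edge_three, exV_edge_zero, h2]
    simp
    norm_num

theorem exd_pos (i : Fin 4) : (0 : ℝ) < ![0.3, 0.15, 0.2, 0.25] i := by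
  fin_cases i <;> norm_num

theorem exδ_ne_lam (i : Fin 4) : exδ i ≠ lam exV i := by
  rw [lam_exV, exδ]
  intro h
  exact (exTan_bounds i).2 (arctan_injective (mul_left_cancel₀ two_ne_zero h))

theorem exf_eq (i : Fin 4) : exf i =
    (1 - ![0.3, 0.15, 0.2, 0.25] i * exTan i) / (1 + ![0.3, 0.15, 0.2, 0.25] i * exTan i) := by
  rw [exf, lam_exV, exδ]
  exact coefficient_two_arctan (exd_pos i) (exTan_bounds i).1 (exTan_bounds i).2

end Example

/-! ### The numerical solution and the resulting flexible block. -/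

section ExampleSolution

open Real Set

theorem exf_mem :
    exf 0 ∈ Icc (0.412202223393083 : ℝ) 0.412202223393086 ∧
    exf 1 ∈ Icc (0.739130434782608 : ℝ) 0.739130434782609 ∧
    exf 2 ∈ Icc (0.690745899853835 : ℝ) 0.690745899853838 ∧
    exf 3 ∈ Icc (0.477592250072516 : ℝ) 0.477592250072518 := by
  have e0 : exf 0 = (1 - 0.3 * ((√10 + 1) / 3)) / (1 + 0.3 * ((√10 + 1) / 3)) := exf_eq 0
  have e1 : exf 1 = (1 - 0.15 * 1) / (1 + 0.15 * 1) := exf_eq 1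
  have e2 : exf 2 = (1 - 0.2 * ((3 * √14 - 1) / (5 * √5))) /
    (1 + 0.2 * ((3 * √14 - 1) / (5 * √5))) := exf_eq 2
  have e3 : exf 3 = (1 - 0.25 * √2) / (1 + 0.25 * √2) := exf_eq 3
  have b0 := exf_zero_mem
  have b2 := exf_two_mem
  have b3 := exf_three_mem
  rw [← e0] at b0
  rw [← e2] at b2
  rw [← e3] at b3
  have b1 : exf 1 ∈ Icc (0.739130434782608 : ℝ) 0.739130434782609 := by
    rw [e1]; constructor <;> norm_num
  exact ⟨b0, b1, b2, b3⟩

theorem exf_pos (i : Fin 4) : 0 < exf i := by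
  obtain ⟨b0, b1, b2, b3⟩ := exf_mem
  fin_cases i
  exacts [lt_of_lt_of_le (by norm_num) b0.1, lt_of_lt_of_le (by norm_num) b1.1,
    lt_of_lt_of_le (by norm_num) b2.1, lt_of_lt_of_le (by norm_num) b3.1]

theorem example_radicands :
    rad₁ 100 exf ∈ Icc (17.5 : ℝ) 17.6 ∧ rad₂ 100 exf ∈ Icc (449 : ℝ) 450 ∧
    den₁ 100 exf ≠ 0 ∧ den₃ 100 exf ≠ 0 ∧
    |exe 1 - (-0.86081001)| < 5e-9 ∧ |exe 2 - (-5.06077939)| < 5e-9 ∧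
    |exe 3 - 0.57043281| < 5e-9 := by
  obtain ⟨b0, b1, b2, b3⟩ := exf_mem
  obtain ⟨r1, r2, d1, d3, n1, n3⟩ := example_bounds b0 b1 b2 b3
  obtain ⟨s1, s2, s3⟩ := example_solution_bounds r1 r2 d1 d3 n1 n3
  have hr1 : 10000 * ((exf 2 * exf 3 - exf 0 * exf 1) * (exf 1 * exf 3 - exf 0 * exf 2)) +
      (exf 2 - exf 0 * exf 1 * exf 3) * (exf 1 - exf 0 * exf 2 * exf 3) = rad₁ 100 exf := by
    rw [rad₁]; ring
  have hr2 : 10000 * ((exf 3 - exf 0 * exf 1 * exf 2) * (exf 0 - exf 1 * exf 2 * exf 3)) -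
      (1 - exf 0 * exf 1 * (exf 2 * exf 3)) * (exf 1 * exf 2 - exf 0 * exf 3) = rad₂ 100 exf := by
    rw [rad₂]; ring
  have hd1 : 10000 * ((exf 1 * exf 3 - exf 0 * exf 2) * (exf 0 - exf 1 * exf 2 * exf 3)) -
      (exf 1 * exf 2 - exf 0 * exf 3) * (exf 1 - exf 0 * exf 2 * exf 3) = -den₁ 100 exf := by
    rw [den₁]; ring
  have hd3 : 10000 * ((exf 1 * exf 3 - exf 0 * exf 2) * (exf 3 - exf 0 * exf 1 * exf 2)) +
      (exf 1 * exf 2 - exf 0 * exf 3) * (exf 2 - exf 0 * exf 1 * exf 3) = den₃ 100 exf := by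
    rw [den₃]; ring
  rw [hr1] at r1 s1 s2 s3
  rw [hr2] at r2 s1 s2 s3
  rw [hd1] at d1 s1
  rw [hd3] at d3 s3
  refine ⟨⟨by linarith [r1.1], by linarith [r1.2]⟩, ⟨by linarith [r2.1], by linarith [r2.2]⟩,
    fun h => ?_, fun h => ?_, ?_, ?_, ?_⟩
  · rw [h] at d1
    exact absurd d1.1 (by norm_num)
  · rw [h] at d3
    exact absurd d3.1 (by norm_num)
  · convert s1 using 1
    rw [abs_sub_comm]
    congr 1
    simp only [exe, explicitSol, Matrix.cons_val, div_neg]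
    ring
  · convert s2 using 1
    rw [abs_sub_comm]
    congr 1
    simp only [exe, explicitSol, Matrix.cons_val, ← den₂.eq_1, rad₁]
    ring
  · convert s3 using 2
    simp only [exe, explicitSol, Matrix.cons_val]
    ring

theorem exe_closure : ClosureEquations exe exf := by
  obtain ⟨r1, r2, d1, d3, -⟩ := example_radicands
  have p1 : 0 < rad₁ 100 exf := by linarith [r1.1]
  -- Positivity of `rad₁` also provides `den₂ ≠ 0`, the two being the same polynomial.
  exact closureEquations_explicitSol 100 exf _ _ 1 (by norm_num) (sq_sqrt p1.le)
    (sq_sqrt (by linarith [r2.1])) d1 p1.ne' d3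

/-- A sufficient condition for a non-planar side face, in terms of edge vectors. -/
theorem sin_add_torsion_ne_zero {V : Fin 4 → E3} (hV : AffineIndependent ℝ V) (i : Fin 4) (e : ℝ)
    (h : 2 * e * inner ℝ (cross (edgeVec V i) (edgeVec V (i + 1)))
        (cross (edgeVec V (i + 1)) (edgeVec V (i + 1 + 1))) +
      (1 - e ^ 2) * (inner ℝ (cross (edgeVec V i) (edgeVec V (i + 1))) (edgeVec V (i + 2)) *
        ‖edgeVec V (i + 1)‖) ≠ 0) :
    sin (2 * arctan e + torsion V (i + 1)) ≠ 0 := by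
  have h1 := norm_ne_zero_iff.mpr (cross_edgeVec_ne_zero hV i)
  have h2 := norm_ne_zero_iff.mpr (cross_edgeVec_ne_zero hV (i + 1))
  have h3 : 1 + e ^ 2 ≠ 0 := by positivity
  intro h0
  apply h
  rw [sin_add, sin_two_arctan, cos_two_arctan, cos_torsion hV, sin_torsion hV, nrm, nrm,
    real_inner_smul_left, real_inner_smul_right] at h0
  field_simp at h0
  linear_combination h0

/-- With integral edge vectors and the numerical bounds on e_i, each expression stays far from zero,
so crude estimates of the square roots suffice. -/
theorem exe_torsion (i : Fin 4) : sin (2 * arctan (exe i) + torsion exV i) ≠ 0 := by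
  obtain ⟨-, -, -, -, h1, h2, h3⟩ := example_radicands
  rw [abs_lt] at h1 h2 h3
  have a0 : exe 0 = 100 := rfl
  have h10 : √10 < 3.2 := (sqrt_lt' (by norm_num)).mpr (by norm_num)
  have h14 := three_lt_sqrt_fourteen
  have key : ∀ j : Fin 4, sin (2 * arctan (exe (j + 1)) + torsion exV (j + 1)) ≠ 0 := by
    intro j
    apply sin_add_torsion_ne_zero exV_affineIndependent
    fin_cases j
    · change 2 * exe 1 * inner ℝ (cross (edgeVec exV 0) (edgeVec exV 1))
        (cross (edgeVec exV 1) (edgeVec exV 2)) + (1 - exe 1 ^ 2) *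
        (inner ℝ (cross (edgeVec exV 0) (edgeVec exV 1)) (edgeVec exV 2) * ‖edgeVec exV 1‖) ≠ 0
      rw [norm_exV_edge_one, exV_edge_zero, exV_edge_one, exV_edge_two]
      simp only [inner_eq, cross_apply_zero, cross_apply_one, cross_apply_two, Matrix.cons_val]
      apply ne_of_lt
      nlinarith [sqrt_nonneg 10, mul_nonneg (sq_nonneg (exe 1)) (sqrt_nonneg 10)]
    · change 2 * exe 2 * inner ℝ (cross (edgeVec exV 1) (edgeVec exV 2))
        (cross (edgeVec exV 2) (edgeVec exV 3)) + (1 - exe 2 ^ 2) *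
        (inner ℝ (cross (edgeVec exV 1) (edgeVec exV 2)) (edgeVec exV 3) * ‖edgeVec exV 2‖) ≠ 0
      rw [norm_exV_edge_two, exV_edge_one, exV_edge_two, exV_edge_three]
      simp only [inner_eq, cross_apply_zero, cross_apply_one, cross_apply_two, Matrix.cons_val]
      apply ne_of_gt
      have h5 : 24 < exe 2 ^ 2 - 1 := by nlinarith
      nlinarith [mul_lt_mul'' h5 h14 (by norm_num) (by norm_num)]
    · change 2 * exe 3 * inner ℝ (cross (edgeVec exV 2) (edgeVec exV 3))
        (cross (edgeVec exV 3) (edgeVec exV 0)) + (1 - exe 3 ^ 2) *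
        (inner ℝ (cross (edgeVec exV 2) (edgeVec exV 3)) (edgeVec exV 0) * ‖edgeVec exV 3‖) ≠ 0
      rw [norm_exV_edge_three, exV_edge_two, exV_edge_three, exV_edge_zero]
      simp only [inner_eq, cross_apply_zero, cross_apply_one, cross_apply_two, Matrix.cons_val]
      apply ne_of_gt
      nlinarith
    · change 2 * exe 0 * inner ℝ (cross (edgeVec exV 3) (edgeVec exV 0))
        (cross (edgeVec exV 0) (edgeVec exV 1)) + (1 - exe 0 ^ 2) *
        (inner ℝ (cross (edgeVec exV 3) (edgeVec exV 0)) (edgeVec exV 1) * ‖edgeVec exV 0‖) ≠ 0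
      rw [norm_exV_edge_zero, exV_edge_three, exV_edge_zero, exV_edge_one, a0]
      simp only [inner_eq, cross_apply_zero, cross_apply_one, cross_apply_two, Matrix.cons_val]
      norm_num
  have := key (i - 1)
  rwa [sub_add_cancel] at this

theorem exδ_spec (i : Fin 4) : 0 < exδ i ∧ exδ i < π ∧ exδ i ≠ lam exV i ∧
    IsCoefficient (lam exV i) (exδ i) (exf i) :=
  ⟨(two_arctan_mem (exd_pos i)).1, (two_arctan_mem (exd_pos i)).2, exδ_ne_lam i, Or.inr rfl⟩

/-- Non-planar corner faces: the corner point is put in the direction `A_i × B_i`. -/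
theorem affineIndependent_corner {p A B : E3} {s t : ℝ} (hs : s ≠ 0) (ht : t ≠ 0)
    (h : inner ℝ A A * inner ℝ B B - inner ℝ A B ^ 2 ≠ (0 : ℝ)) :
    AffineIndependent ℝ ![p, p + t • B, p + cross A B, p + s • A] := by
  rw [affineIndependent_iff_tetVol]
  simp only [tetVol, Matrix.cons_val, add_sub_cancel_left]
  have key : inner ℝ (cross (t • B) (cross A B)) (s • A) =
      t * s * (inner ℝ A A * inner ℝ B B - inner ℝ A B ^ 2) := by
    rw [cross_smul_left, real_inner_smul_left, real_inner_smul_right]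
    simp only [inner_eq, cross_apply_zero, cross_apply_one, cross_apply_two]
    ring
  rw [key]
  exact mul_ne_zero (mul_ne_zero ht hs) h

/-- Any starting angle works. The lengths ±1 have opposite signs, and W_i = V_i + A_i × B_i leaves
the plane of A_i, B_i because sin λ_i ≠ 0. -/
theorem exists_example : ∃ (α β s t : Fin 4 → ℝ) (W : Fin 4 → E3),
    IsConfiguration exe exf α β ∧ (∀ i, s i * t i < 0) ∧
    IsSQSurface (blockOf exV exδ α β s t W) ∧ IsVHedron (blockOf exV exδ α β s t W) ∧
    ContinuouslyFlexible (blockOf exV exδ α β s t W) := by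
  have hV := exV_affineIndependent
  have hf : ∀ i, exf i ≠ 0 := fun i => (exf_pos i).ne'
  obtain ⟨a, b, -, -, -, hab⟩ := exists_continuous_configuration hf exe_closure
  have hst : ∀ i : Fin 4, (fun _ => 1 : Fin 4 → ℝ) i * (fun _ => -1 : Fin 4 → ℝ) i < 0 :=
    fun _ => by norm_num
  refine ⟨a 0, b 0, fun _ => 1, fun _ => -1, fun i => exV i + cross
    (sphA exV i (exδ i) (a 0 i)) (sphB exV i (exδ i) (b 0 i)), hab 0, hst,
    (isSQSurface_blockOf_iff hV (fun i => ⟨(exδ_spec i).1, (exδ_spec i).2.1⟩) (hab 0) hst _).mpr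
      ⟨exe_torsion, fun i => ?_⟩,
    isVHedron_blockOf hV exδ_spec (hab 0) hst _,
    continuouslyFlexible_blockOf hV hf exδ_spec exe_closure (hab 0) hst _⟩
  apply affineIndependent_corner one_ne_zero (by norm_num)
  rw [inner_sphA_self hV, inner_sphB_self hV, inner_sphA_sphB hV i (exδ_spec i) (hab 0 i).1,
    one_mul, ← sin_sq_add_cos_sq (lam exV i), add_sub_cancel_right]
  exact pow_ne_zero 2 (sin_lam_pos hV i).ne'

end ExampleSolution

end SkewVHedra

end

theorem mainTheorem4 :
    -- the closure condition `a₄ = a₀` is the quadratic equation with coefficients `q₂, q₁, q₀`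
    (∀ (K : Type) [RCLike K] (e f : Fin 4 → K) (a : Fin 5 → K),
      (∀ i : Fin 4,
        1 - a i.castSucc * f i * e (i + 1) ≠ 0 ∧
        a i.succ = (a i.castSucc * f i + e (i + 1)) / (1 - a i.castSucc * f i * e (i + 1))) →
      (a 0 - a 4 = 0 ↔
        SkewVHedra.q₂ e f * a 0 ^ 2 + SkewVHedra.q₁ e f * a 0 + SkewVHedra.q₀ e f = 0)) ∧
    -- explicit solution of the closure equations over `ℝ` and over `ℂ`
    (∀ (K : Type) [RCLike K] (e₀ : K) (f : Fin 4 → K) (R₁ R₂ : K),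
      R₁ ^ 2 = SkewVHedra.rad₁ e₀ f → R₂ ^ 2 = SkewVHedra.rad₂ e₀ f →
      SkewVHedra.den₁ e₀ f ≠ 0 → SkewVHedra.den₂ e₀ f ≠ 0 → SkewVHedra.den₃ e₀ f ≠ 0 →
      SkewVHedra.ClosureEquations (SkewVHedra.explicitSol e₀ f R₁ R₂ 1) f ∧
      SkewVHedra.ClosureEquations (SkewVHedra.explicitSol e₀ f R₁ R₂ (-1)) f ∧
      ((∀ i, f i ≠ 0) → ∀ e : Fin 4 → K, e 0 = e₀ → (∀ i, e i ^ 2 ≠ -1) →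
        SkewVHedra.ClosureEquations e f →
        e = SkewVHedra.explicitSol e₀ f R₁ R₂ 1 ∨
        e = SkewVHedra.explicitSol e₀ f R₁ R₂ (-1))) ∧
    -- the missing parameter `δ` is uniquely determined by `λ` and `f`
    (∀ l f : ℝ, 0 < l → l < Real.pi → f ≠ 0 → f ≠ 1 → f ≠ -1 → f ≠ Real.cos l →
      ∃! δ : ℝ, 0 < δ ∧ δ < Real.pi ∧ δ ≠ l ∧ SkewVHedra.IsCoefficient l δ f) ∧
    -- real solutions yield continuously flexible building blocks over any skew central quad
    (∀ (V : Fin 4 → SkewVHedra.E3) (e f δ : Fin 4 → ℝ), AffineIndependent ℝ V →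
      (∀ i, f i ≠ 0) →
      (∀ i, 0 < δ i ∧ δ i < Real.pi ∧ δ i ≠ SkewVHedra.lam V i ∧
        SkewVHedra.IsCoefficient (SkewVHedra.lam V i) (δ i) (f i)) →
      SkewVHedra.ClosureEquations e f →
      (∀ α₀ : ℝ, ∃ α β : Fin 4 → ℝ, α 0 = α₀ ∧ SkewVHedra.IsConfiguration e f α β) ∧
      ∀ (α β s t : Fin 4 → ℝ) (W : Fin 4 → SkewVHedra.E3),
        SkewVHedra.IsConfiguration e f α β → (∀ i, s i * t i < 0) →
        SkewVHedra.IsVHedron (SkewVHedra.blockOf V δ α β s t W) ∧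
        SkewVHedra.ContinuouslyFlexible (SkewVHedra.blockOf V δ α β s t W) ∧
        (SkewVHedra.IsSQSurface (SkewVHedra.blockOf V δ α β s t W) ↔
          (∀ i, Real.sin (2 * Real.arctan (e i) + SkewVHedra.torsion V i) ≠ 0) ∧
          ∀ i, AffineIndependent ℝ
            ![V i, V i + t i • SkewVHedra.sphB V i (δ i) (β i), W i,
              V i + s i • SkewVHedra.sphA V i (δ i) (α i)])) ∧
    -- the example
    (AffineIndependent ℝ SkewVHedra.exV ∧
      (∀ i, 0 < SkewVHedra.exδ i ∧ SkewVHedra.exδ i < Real.pi ∧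
        SkewVHedra.exδ i ≠ SkewVHedra.lam SkewVHedra.exV i ∧ SkewVHedra.exf i ≠ 0) ∧
      0 < SkewVHedra.rad₁ 100 SkewVHedra.exf ∧ 0 < SkewVHedra.rad₂ 100 SkewVHedra.exf ∧
      SkewVHedra.ClosureEquations SkewVHedra.exe SkewVHedra.exf ∧
      |SkewVHedra.exe 1 - (-0.86081001)| < 5e-9 ∧
      |SkewVHedra.exe 2 - (-5.06077939)| < 5e-9 ∧
      |SkewVHedra.exe 3 - 0.57043281| < 5e-9 ∧
      ∃ (α β s t : Fin 4 → ℝ) (W : Fin 4 → SkewVHedra.E3),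
        SkewVHedra.IsConfiguration SkewVHedra.exe SkewVHedra.exf α β ∧ (∀ i, s i * t i < 0) ∧
        SkewVHedra.IsSQSurface
          (SkewVHedra.blockOf SkewVHedra.exV SkewVHedra.exδ α β s t W) ∧
        SkewVHedra.IsVHedron
          (SkewVHedra.blockOf SkewVHedra.exV SkewVHedra.exδ α β s t W) ∧
        SkewVHedra.ContinuouslyFlexible
          (SkewVHedra.blockOf SkewVHedra.exV SkewVHedra.exδ α β s t W)) ∧
    -- continuously flexible skew-quad surfaces exist
    (∃ X : SkewVHedra.QuadMesh 3 3, SkewVHedra.IsSQSurface X ∧ SkewVHedra.IsVHedron X ∧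
      SkewVHedra.ContinuouslyFlexible X) := by

  open SkewVHedra in
  refine ⟨fun K _ e f a h => closure_iff_quadratic e f a h, ?_, ?_, ?_, ?_, ?_⟩
  · intro K _ e₀ f R₁ R₂ h₁ h₂ d₁ d₂ d₃
    refine ⟨closureEquations_explicitSol e₀ f R₁ R₂ 1 (by norm_num) h₁ h₂ d₁ d₂ d₃,
      closureEquations_explicitSol e₀ f R₁ R₂ (-1) (by norm_num) h₁ h₂ d₁ d₂ d₃, ?_⟩
    rintro hf e rfl he h
    exact eq_explicitSol_of_closure e f R₁ R₂ h₁ h₂ d₁ d₂ d₃ hf he h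
  · intro l f hl hl' _ h1 h2 h3
    exact existsUnique_delta hl hl' h1 h2 h3
  · intro V e f δ hV hf hδ he
    refine ⟨fun α₀ => ?_, fun α β s t W hc hst => ⟨isVHedron_blockOf hV hδ hc hst W,
      continuouslyFlexible_blockOf hV hf hδ he hc hst W,
      isSQSurface_blockOf_iff hV (fun i => ⟨(hδ i).1, (hδ i).2.1⟩) hc hst W⟩⟩
    obtain ⟨a, b, -, -, ha, hab⟩ := exists_continuous_configuration hf he
    exact ⟨a α₀, b α₀, ha α₀, hab α₀⟩
  · obtain ⟨r1, r2, -, -, h⟩ := example_radicands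
    exact ⟨exV_affineIndependent, fun i => ⟨(exδ_spec i).1, (exδ_spec i).2.1, exδ_ne_lam i,
      (exf_pos i).ne'⟩, by linarith [r1.1], by linarith [r2.1], exe_closure, h.1, h.2.1, h.2.2,
      exists_example⟩
  · obtain ⟨α, β, s, t, W, -, -, h⟩ := exists_example
    exact ⟨_, h⟩
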